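/- **Sentences.** Let $\sigma$ be a vocabulary with unary predicates $U_1,\dots,U_n$ and binary predicates $R_1,\dots,R_m$. A $\mathrm{GP}^2$ sentence $\varphi$ over $\sigma$ in normal form is $$\varphi=\forall x\,\gamma(x)\ \wedge\bigwedge_{i\le m}\forall x\forall y\,\big((R_i(x,y)\wedge x\ne y)\to\alpha_i(x,y)\big)\ \wedge\bigwedge_{i\le n}\forall x\,\big(U_i(x)\to P_i(x)\big),$$ $$P_i(x)=\Big(\sum_{t\le m}\lambda_{i,t}\cdot\#_y[R_t(x,y)\wedge x\neq y]\ \circledast_i\ \delta_i\Big),$$ with $\gamma,\alpha_i$ quantifier-free, $\lambda_{i,t},\delta_i\in\mathbb Z$ and $\circledast_i\in\{=,\le,<,\ge,>\}$. It is finitely satisfiable if it has a finite nonempty model. **Types.** A 1-type is a maximal consistent set of literals over the atoms $U_i(x)$, $R_i(x,x)$. A 2-type is a maximal consistent set of literals over the atoms $R_i(x,y)$, $R_i(y,x)$. The dual $\bar\eta$ of a 2-type $\eta$ swaps $x$ and $y$. A 2-type is audible if it contains at least one positive literal. Let $T$ be the set of 1-types and $E^+$ the set of audible 2-types. A 1-type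 $\pi$ is compatible with $\varphi$ if $\pi(x)\models\gamma(x)$; let $T^\varphi\subseteq T$ be the set of these. A triple $\langle\pi_1,\eta,\pi_2\rangle$ is compatible with $\varphi$ if both $\pi_1(x)\wedge\eta(x,y)\wedge\pi_2(y)$ and $\pi_2(x)\wedge\bar\eta(x,y)\wedge\pi_1(y)$ entail $\bigwedge_i\big((R_i(x,y)\wedge x\ne y)\to\alpha_i(x,y)\big)$. **Characteristic system.** For a 1-type $\pi$, the system $\mathcal C^\varphi_\pi$ has variables $x_{\eta,\pi'}$ ($\eta\in E^+$, $\pi'\in T$) and the following constraints: - $x_{\eta,\pi'}=0$ whenever $\pi'$ or $\langle\pi,\eta,\pi'\rangle$ is not compatible with $\varphi$; - $\sum_t\lambda_{i,t}\sum_{\eta\in E^+,\,R_t(x,y)\in\eta}\ \sum_{\pi'\in T}x_{\eta,\pi'}\ \circledast_i\ \delta_i$ for each $i$ with $U_i(x)\in\pi$. Let $\mathcal B^\varphi_\pi$ be its set of solutions in $\mathbb N$. **Kleene-star system.** Let $A\mathbf x=\mathbf c$ be a system of $M$ integer equations in $N$ variables with a fixed order. Let $\|\cdot\|$ be the maximal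 absolute value of the entries, $L=((N+1)\|A\|+\|\mathbf c\|+1)^{M}$ and $D=N\|A\|L$. Consider the automaton over the letters $a_1,\dots,a_N$ whose states are an initial state, an accepting state, and all $\langle i,t,\mathbf v\rangle$ with $1\le i\le N$, $1\le t\le L$, $\mathbf v\in\{-D,\dots,D\}^{M}$. Its transitions reading $a_j$ are, with $A_j$ the $j$-th column of $A$: - from the initial state to $\langle j,1,A_j\rangle$, and also to the accepting state if $A_j=\mathbf c$; - from $\langle j,t,\mathbf v\rangle$ with $t<L$ to $\langle j,t+1,\mathbf v+A_j\rangle$, and also to the accepting state if $\mathbf v+A_j=\mathbf c$; - from $\langle i,t,\mathbf v\rangle$ with $i<j$ to $\langle j,1,\mathbf v+A_j\rangle$, and also to the accepting state if $\mathbf v+A_j=\mathbf c$ (transitions to states that do not exist are omitted). Let $B$ be the letters $\times$ transitions matrix with entry $1$ where the transition reads the letter and $0$ elsewhere. Let $F$ be the states $\times$ transitions matrix whose rows at the initial and the accepting state vanish and which in every other row has $1$ at the transitions entering the state, $-1$ at those leaving it and $0$ elsewhere. Put $\tilde A=\begin{pmatrix}-I&B\\0&F\end{pmatrix}$. The Kleene-star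 system of $A\mathbf x=\mathbf c$ is $$\exists\mathbf y_1,\mathbf y_2\ \ \mathbf x=\mathrm{proj}_N(\mathbf y_1)+\mathbf y_2\ \wedge\ \tilde A\mathbf y_1=\mathbf 0\ \wedge\ A\mathbf y_2=\mathbf 0\ \wedge\ (\mathbf y_1=\mathbf 0\to\mathbf y_2=\mathbf 0),$$ where $\mathbf y_1,\mathbf y_2$ range over vectors of natural numbers and $\mathrm{proj}_N$ takes the first $N$ entries. Let $\tilde{\mathcal C}^\varphi_\pi$ be the Kleene-star system of $\mathcal C^\varphi_\pi$, where each inequality of $\mathcal C^\varphi_\pi$ is first turned into an equation by a slack variable in $\mathbb N$ and the slack variables are existentially quantified in the resulting Kleene-star system. **The system $\mathcal Q^\varphi$.** Its variables are $x_{\pi_1,\eta,\pi_2}$ with $\pi_1,\pi_2\in T^\varphi$ and $\eta\in E^+$. It consists of: - (Structure) $\tilde{\mathcal C}^\varphi_\pi(\mathbf x_\pi)$ for every $\pi\in T^\varphi$, where $\mathbf x_\pi$ has the entry $x_{\pi,\eta,\pi'}$ at $(\eta,\pi')$ if $\pi'\in T^\varphi$ and $0$ if $\pi'\notin T^\varphi$;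 - (Matching) $x_{\pi_1,\eta,\pi_2}=x_{\pi_2,\bar\eta,\pi_1}$ for all $\pi_1,\pi_2\in T^\varphi$ and $\eta\in E^+$; - (Non-triviality) $\sum_{\pi_1,\eta,\pi_2}x_{\pi_1,\eta,\pi_2}>0$. **Lemma.** Let $\varphi$ be a $\mathrm{GP}^2$ sentence in normal form such that $\mathbf 0\notin\mathcal B^\varphi_\pi$ for every $\pi\in T^\varphi$. Then $\varphi$ is finitely satisfiable if and only if $\mathcal Q^\varphi$ has a solution in $\mathbb N$. -/

import Mathlib

noncomputable section

namespace GP2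

/-! ## Integer linear systems over the natural numbers -/

/-- The comparison signs that may occur in a linear constraint. -/
inductive Cmp
  | eq | le | lt | ge | gt
  deriving DecidableEq

/-- The meaning of a comparison sign. -/
def Cmp.Holds : Cmp → ℤ → ℤ → Prop
  | .eq, a, b => a = b
  | .le, a, b => a ≤ b
  | .lt, a, b => a < b
  | .ge, a, b => a ≥ b
  | .gt, a, b => a > b

/-- The coefficient of the slack variable that turns a comparison into an equation:
`a ≤ c` iff `a + s = c` for some `s ∈ ℕ`, and `a ≥ c` iff `a - s = c` for some `s ∈ ℕ`. -/
def Cmp.slackCoeff : Cmp → ℤ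
  | .eq => 0
  | .le => 1
  | .lt => 1
  | .ge => -1
  | .gt => -1

/-- Over the integers `a < c` is `a ≤ c - 1`, and `a > c` is `a ≥ c + 1`. -/
def Cmp.shift : Cmp → ℤ
  | .eq => 0
  | .le => 0
  | .lt => -1
  | .ge => 0
  | .gt => 1

/-- A finite system of linear constraints `(A x)_r ⊛_r c_r`, with constraints indexed by `κ`
and variables indexed by `ι`. -/
structure LinSystem (κ ι : Type) where
  /-- the coefficients -/
  A : Matrix κ ι ℤ
  /-- the comparison sign of each constraint -/
  rel : κ → Cmp
  /-- the constant of each constraint -/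
  c : κ → ℤ

/-- A vector of natural numbers, seen as a vector of integers. -/
def toInt {ι : Type} (x : ι → ℕ) : ι → ℤ := fun i => (x i : ℤ)

/-- The set of solutions in `ℕ`. -/
def LinSystem.sol {κ ι : Type} [Fintype ι] (S : LinSystem κ ι) : Set (ι → ℕ) :=
  {x | ∀ r, (S.rel r).Holds (S.A.mulVec (toInt x) r) (S.c r)}

/-- The indices of the slack variables: one for each constraint that is not an equation. -/
abbrev LinSystem.Slack {κ ι : Type} (S : LinSystem κ ι) : Type := {r : κ // S.rel r ≠ Cmp.eq}

open Classical in
/-- The coefficient matrix of the system of equations `A x + (slack) = c'`. -/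
def LinSystem.eqA {κ ι : Type} (S : LinSystem κ ι) : Matrix κ (ι ⊕ S.Slack) ℤ :=
  Matrix.fromCols S.A
    (Matrix.of fun r s => if s.1 = r then (S.rel r).slackCoeff else 0)

/-- The right-hand side of the system of equations `A x + (slack) = c'`. -/
def LinSystem.eqC {κ ι : Type} (S : LinSystem κ ι) : κ → ℤ :=
  fun r => S.c r + (S.rel r).shift

/-! ## The system describing the Kleene star of the solutions of `A x = c` -/

section Key

variable {κ ι : Type} [Fintype κ] [Fintype ι]

/-- `‖A‖`: the maximal absolute value of the entries of a matrix. -/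
def matNorm (A : Matrix κ ι ℤ) : ℕ :=
  Finset.univ.sup fun p : κ × ι => (A p.1 p.2).natAbs

/-- `‖c‖`: the maximal absolute value of the entries of a vector. -/
def vecNorm (c : κ → ℤ) : ℕ :=
  Finset.univ.sup fun r : κ => (c r).natAbs

/-- `L = ((n + 1) ‖A‖ + ‖c‖ + 1) ^ m`, for `m` equations in `n` variables. -/
def boundL (A : Matrix κ ι ℤ) (c : κ → ℤ) : ℕ :=
  ((Fintype.card ι + 1) * matNorm A + vecNorm c + 1) ^ Fintype.card κ

/-- `D = n ‖A‖ L`. -/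
def boundD (A : Matrix κ ι ℤ) (c : κ → ℤ) : ℕ :=
  Fintype.card ι * matNorm A * boundL A c

/-- A fixed ordering of the variables, that is, of the letters `a_i` of the automaton. -/
def pos (i : ι) : Fin (Fintype.card ι) := Fintype.equivFin ι i

/-- The states of the automaton of `A x = c`: an initial state, an accepting state, and
the states `⟨i, t, v⟩` with `1 ≤ t ≤ L` and `v ∈ {-D, …, D} ^ m`. In the state `⟨i, t, v⟩` the last
letter read is `a_i`, it has been read `t` times, and `A` times the Parikh vector of the word read
so far is `v`. -/
inductive State (A : Matrix κ ι ℤ) (c : κ → ℤ) : Type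
  | init : State A c
  | mid (i : ι) (t : Finset.Icc 1 (boundL A c))
      (v : κ → Finset.Icc (-(boundD A c : ℤ)) (boundD A c : ℤ)) : State A c
  | acc : State A c

/-- The transitions of the automaton. It accepts the words of `a_1^* a_2^* ⋯ a_n^*`
whose Parikh vector `x` is nonzero with entries at most `L` and satisfies `A x = c`. -/
def Step (A : Matrix κ ι ℤ) (c : κ → ℤ) : State A c → ι → State A c → Prop
  | .init, j, .mid j' t' v' =>
      j' = j ∧ t'.1 = 1 ∧ ∀ r, (v' r).1 = A r j
  | .init, j, .acc =>
      ∀ r, A r j = c r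
  | .mid i t v, j, .mid j' t' v' =>
      j' = j ∧ (∀ r, (v' r).1 = (v r).1 + A r j) ∧
        ((i = j ∧ t'.1 = t.1 + 1) ∨ (pos i < pos j ∧ t'.1 = 1))
  | .mid i t v, j, .acc =>
      (∀ r, (v r).1 + A r j = c r) ∧
        ((i = j ∧ t.1 + 1 ≤ boundL A c) ∨ pos i < pos j)
  | _, _, _ => False

/-- The set of transitions `(p, a_j, q)`. -/
abbrev Trans (A : Matrix κ ι ℤ) (c : κ → ℤ) : Type :=
  {e : State A c × ι × State A c // Step A c e.1 e.2.1 e.2.2}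

instance (A : Matrix κ ι ℤ) (c : κ → ℤ) : Finite (State A c) := by
  let f : Option (Option (ι × Finset.Icc 1 (boundL A c) ×
      (κ → Finset.Icc (-(boundD A c : ℤ)) (boundD A c : ℤ)))) → State A c := fun s =>
    match s with
    | none => State.init
    | some none => State.acc
    | some (some p) => State.mid p.1 p.2.1 p.2.2
  refine Finite.of_surjective f ?_
  rintro (_ | ⟨i, t, v⟩ | _)
  · exact ⟨none, rfl⟩
  · exact ⟨some (some (i, t, v)), rfl⟩
  · exact ⟨some none, rfl⟩

instance (A : Matrix κ ι ℤ) (c : κ → ℤ) : Fintype (State A c) := Fintype.ofFinite _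

instance (A : Matrix κ ι ℤ) (c : κ → ℤ) : Fintype (Trans A c) := Fintype.ofFinite _

open Classical in
/-- The letter-incidence matrix `B` of the automaton. -/
def labelMat (A : Matrix κ ι ℤ) (c : κ → ℤ) : Matrix ι (Trans A c) ℤ :=
  Matrix.of fun i e => if e.1.2.1 = i then 1 else 0

open Classical in
/-- The flow-conservation matrix of the automaton: the rows of the initial and the accepting state
vanish, and every other state has entry `1` at its incoming and `-1` at its outgoing transitions. -/
def flowMat (A : Matrix κ ι ℤ) (c : κ → ℤ) : Matrix (State A c) (Trans A c) ℤ :=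
  Matrix.of fun q e =>
    if q = State.init ∨ q = State.acc then 0
    else if e.1.2.2 = q then 1
    else if e.1.1 = q then -1
    else 0

open Classical in
/-- The block matrix `Ã = [-I, B; 0, A_M]`. -/
def tildeA (A : Matrix κ ι ℤ) (c : κ → ℤ) : Matrix (ι ⊕ State A c) (ι ⊕ Trans A c) ℤ :=
  Matrix.fromBlocks (-1) (labelMat A c) 0 (flowMat A c)

/-- `x` is a solution in `ℕ` of the system
`∃ y₁ y₂, x = proj y₁ + y₂ ∧ Ã y₁ = 0 ∧ A y₂ = 0 ∧ (y₁ = 0 → y₂ = 0)`. -/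
def TildeSol (A : Matrix κ ι ℤ) (c : κ → ℤ) (x : ι → ℕ) : Prop :=
  ∃ (y₁ : ι ⊕ Trans A c → ℕ) (y₂ : ι → ℕ),
    (∀ i, x i = y₁ (Sum.inl i) + y₂ i) ∧
    (tildeA A c).mulVec (toInt y₁) = 0 ∧
    A.mulVec (toInt y₂) = 0 ∧
    (y₁ = 0 → y₂ = 0)

end Key

/-- The same system for a system with inequalities: the slack variables of the
associated system of equations are existentially quantified. -/
def LinSystem.TildeSol {κ ι : Type} [Fintype κ] [Fintype ι] (S : LinSystem κ ι)
    (x : ι → ℕ) : Prop :=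
  ∃ s : S.Slack → ℕ, GP2.TildeSol S.eqA S.eqC (Sum.elim x s)

/-! ## Vocabulary, sentences in normal form, and finite satisfiability -/

/-- The predicate symbols: unary `U_1, …, U_n` and binary `R_1, …, R_m`. -/
inductive Pred (n m : ℕ) : ℕ → Type
  | U (i : Fin n) : Pred n m 1
  | R (i : Fin m) : Pred n m 2

/-- The vocabulary with the predicates `U_1, …, U_n`, `R_1, …, R_m` and no function symbols. -/
abbrev voc (n m : ℕ) : FirstOrder.Language.{0, 0} := ⟨fun _ => Empty, Pred n m⟩

/-- `U_i(a)` holds in the structure. -/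
def HoldsU {n m : ℕ} {M : Type} [(voc n m).Structure M] (i : Fin n) (a : M) : Prop :=
  FirstOrder.Language.Structure.RelMap (L := voc n m) (Pred.U i) ![a]

/-- `R_i(a, b)` holds in the structure. -/
def HoldsR {n m : ℕ} {M : Type} [(voc n m).Structure M] (i : Fin m) (a b : M) : Prop :=
  FirstOrder.Language.Structure.RelMap (L := voc n m) (Pred.R i) ![a, b]

/-- A sentence
`∀x γ(x) ∧ ⋀_{i ≤ m} ∀x ∀y ((R_i(x,y) ∧ x ≠ y) → α_i(x,y)) ∧ ⋀_{i ≤ n} ∀x (U_i(x) → P_i(x))`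
in normal form, where
`P_i(x) = (∑_t λ_{i,t} · #_y[R_t(x,y) ∧ x ≠ y] ⊛_i δ_i)`. In `γ` the variable `x` is `0`, and
in `α_i` the variables `x`, `y` are `0`, `1`. -/
structure NormalForm (n m : ℕ) where
  /-- the unary universal part -/
  γ : (voc n m).Formula (Fin 1)
  γ_qf : γ.IsQF
  /-- the binary universal part -/
  α : Fin m → (voc n m).Formula (Fin 2)
  α_qf : ∀ i, (α i).IsQF
  /-- the coefficients of the Presburger quantifiers -/
  coeff : Fin n → Fin m → ℤ
  /-- the comparison signs of the Presburger quantifiers -/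
  rel : Fin n → Cmp
  /-- the constants of the Presburger quantifiers -/
  δ : Fin n → ℤ

namespace NormalForm

variable {n m : ℕ}

/-- The finite structure `M` is a model of `φ`. -/
def Models (φ : NormalForm n m) (M : Type) [Finite M] [(voc n m).Structure M] : Prop :=
  (∀ a : M, φ.γ.Realize ![a]) ∧
  (∀ i, ∀ a b : M, HoldsR (n := n) i a b ∧ a ≠ b → (φ.α i).Realize ![a, b]) ∧
  (∀ i, ∀ a : M, HoldsU (m := m) i a →
    (φ.rel i).Holds
      (∑ t, φ.coeff i t * (Nat.card {b : M // HoldsR (n := n) t a b ∧ a ≠ b} : ℤ)) (φ.δ i))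

/-- `φ` has a finite (nonempty) model. -/
def FinitelySatisfiable (φ : NormalForm n m) : Prop :=
  ∃ (M : Type) (_ : Finite M) (_ : Nonempty M) (_ : (voc n m).Structure M), φ.Models M

end NormalForm

/-! ## Types -/

/-- 1-types, as truth assignments to the atoms `U_i(x)` (first component) and
`R_i(x, x)` (second component). -/
abbrev OneTp (n m : ℕ) : Type := (Fin n → Bool) × (Fin m → Bool)

/-- 2-types, as truth assignments to the atoms `R_i(x, y)` (first component) and
`R_i(y, x)` (second component). -/
abbrev TwoTp (m : ℕ) : Type := (Fin m → Bool) × (Fin m → Bool)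

/-- The silent 2-type, in which all atoms are negated. -/
def silent (m : ℕ) : TwoTp m := (fun _ => false, fun _ => false)

/-- The audible 2-types. -/
abbrev AudTp (m : ℕ) : Type := {η : TwoTp m // η ≠ silent m}

/-- The dual of a 2-type, with `x` and `y` swapped. -/
def dual {m : ℕ} (η : TwoTp m) : TwoTp m := (η.2, η.1)

theorem dual_ne_silent {m : ℕ} {η : TwoTp m} (h : η ≠ silent m) : dual η ≠ silent m :=
  fun e => h (Prod.ext (congrArg Prod.snd e) (congrArg Prod.fst e))

/-- The dual of an audible 2-type is audible. -/
def AudTp.dual {m : ℕ} (η : AudTp m) : AudTp m := ⟨GP2.dual η.1, dual_ne_silent η.2⟩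

/-- The element `a` of a structure has 1-type `π`. -/
def HasOneTp {n m : ℕ} {M : Type} [(voc n m).Structure M] (a : M) (π : OneTp n m) : Prop :=
  (∀ i, π.1 i = true ↔ HoldsU (m := m) i a) ∧ (∀ i, π.2 i = true ↔ HoldsR (n := n) i a a)

/-- The pair `(a, b)` of elements of a structure has 2-type `η`. -/
def HasTwoTp {m : ℕ} (n : ℕ) {M : Type} [(voc n m).Structure M] (a b : M) (η : TwoTp m) : Prop :=
  (∀ i, η.1 i = true ↔ HoldsR (n := n) i a b) ∧ (∀ i, η.2 i = true ↔ HoldsR (n := n) i b a)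

namespace NormalForm

variable {n m : ℕ} (φ : NormalForm n m)

/-- The 1-type `π` is compatible with `φ`: `π(x) ⊨ γ(x)`. -/
def Compat₁ (π : OneTp n m) : Prop :=
  ∀ (M : Type) [Finite M] [(voc n m).Structure M] (a : M),
    HasOneTp a π → φ.γ.Realize ![a]

/-- `π₁(x) ∧ η(x,y) ∧ π₂(y) ⊨ ⋀_i ((R_i(x,y) ∧ x ≠ y) → α_i(x,y))`. -/
def Entails₂ (π₁ : OneTp n m) (η : TwoTp m) (π₂ : OneTp n m) : Prop :=
  ∀ (M : Type) [Finite M] [(voc n m).Structure M] (a b : M),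
    HasOneTp a π₁ → HasTwoTp n a b η → HasOneTp b π₂ →
      ∀ i, HoldsR (n := n) i a b ∧ a ≠ b → (φ.α i).Realize ![a, b]

/-- The triple `⟨π₁, η, π₂⟩` is compatible with `φ`. -/
def Compat₂ (π₁ : OneTp n m) (η : TwoTp m) (π₂ : OneTp n m) : Prop :=
  φ.Entails₂ π₁ η π₂ ∧ φ.Entails₂ π₂ (dual η) π₁

/-- The set of 1-types that are compatible with `φ`. -/
abbrev CompatTp : Type := {π : OneTp n m // φ.Compat₁ π}

instance : Fintype φ.CompatTp := Fintype.ofFinite _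

/-! ## The characteristic system and the system `Q^φ` -/

/-- The constraints of the characteristic system of `φ` and `π`: one for each pair `(η, π')` that
violates compatibility, and one for each `i` with `U_i(x) ∈ π`. -/
abbrev CharRow (π : OneTp n m) : Type :=
  {p : AudTp m × OneTp n m // ¬ (φ.Compat₁ p.2 ∧ φ.Compat₂ π p.1.1 p.2)} ⊕
    {i : Fin n // π.1 i = true}

instance (π : OneTp n m) : Fintype (φ.CharRow π) := Fintype.ofFinite _

/-- The characteristic system of `φ` and `π`, in the variables `x_{η, π'}`, with constraints
`x_{η, π'} = 0` if `π'` or `⟨π, η, π'⟩` is not compatible with `φ`, and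
`(∑_t λ_{i,t} ∑_{η ∋ R_t(x,y)} ∑_{π'} x_{η, π'}) ⊛_i δ_i` if `U_i(x) ∈ π`. -/
def charSystem (π : OneTp n m) : LinSystem (φ.CharRow π) (AudTp m × OneTp n m) where
  A := Matrix.of fun r q => match r with
    | .inl p => if q = p.1 then 1 else 0
    | .inr i => ∑ t, φ.coeff i.1 t * (if q.1.1.1 t = true then 1 else 0)
  rel := fun r => match r with
    | .inl _ => Cmp.eq
    | .inr i => φ.rel i.1
  c := fun r => match r with
    | .inl _ => 0
    | .inr i => φ.δ i.1

/-- The set of behavior vectors that are compatible with `φ` and `π`. -/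
def behaviors (π : OneTp n m) : Set (AudTp m × OneTp n m → ℕ) := (φ.charSystem π).sol

open Classical in
/-- The vector `x_π` of the variables `x_{π, η, π'}`, as a vector over all pairs `(η, π')`;
there are no variables for the 1-types `π'` that are not compatible with `φ`, and their entries
are `0`. -/
def row (x : φ.CompatTp → AudTp m → φ.CompatTp → ℕ) (π : φ.CompatTp) :
    AudTp m × OneTp n m → ℕ :=
  fun p => if h : φ.Compat₁ p.2 then x π p.1 ⟨p.2, h⟩ else 0

/-- `x` is a solution in `ℕ` of the system `Q^φ`. -/
structure IsSolutionQ (x : φ.CompatTp → AudTp m → φ.CompatTp → ℕ) : Prop where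
  /-- Structure: `x_π` solves the system obtained from the characteristic system of `φ` and `π`. -/
  structural : ∀ π : φ.CompatTp, (φ.charSystem π.1).TildeSol (φ.row x π)
  /-- Matching -/
  matching : ∀ (π₁ : φ.CompatTp) (η : AudTp m) (π₂ : φ.CompatTp), x π₁ η π₂ = x π₂ η.dual π₁
  /-- Non-triviality -/
  nontrivial : 0 < ∑ π₁ : φ.CompatTp, ∑ η : AudTp m, ∑ π₂ : φ.CompatTp, x π₁ η π₂

end NormalForm

end GP2

end

/-! The hinge is that the Kleene-star system describes exactly the finite sums of solutions of a
system that `0` does not solve (`LinSystem.tildeSol_iff_exists_list`). With slack variables the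
system becomes `A x = c` with `c ≠ 0`. A pigeonhole argument puts below each solution `x` a solution
`p` with entries at most `L` (`exists_small_solution_le`); the rest `x - p` is homogeneous and goes
into `y₂`, while `p` is the Parikh vector of an accepted word, hence of a flow through the
automaton. Conversely, the automaton has no cycles, so a conserved flow splits into accepting runs
(`exists_list_of_excess`), and `y₂` is added to one of the resulting solutions. The clause `y₁ = 0 →
y₂ = 0` ensures that there is one to receive it.

From a finite model, let `x` count the pairs of distinct elements by their types. Its row at `π` is
the sum of the behavior vectors of the elements of type `π`, matching is the swap of a pair, and
non-triviality holds because no behavior vector is zero.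

From a solution of `Q`, each row is a list of behavior vectors. Take one element for each list entry
and give it as many stubs labelled `(η, π')` as its vector demands. By matching, dual classes of
stubs have equal size, so an involution pairs them (`exists_involution`). The multigraph obtained
may have loops, parallel edges and stubs paired with themselves. The lift to `V × (S → ZMod 4)`,
where each stub `s` translates by its own vector `shift σ s`, removes these defects and keeps all
neighbor counts (`Joins.card_eq`). The result is a finite model
(`finitelySatisfiable_of_behaviors`). -/

noncomputable section

namespace GP2

/-! ### Small solutions of linear equations over `ℕ`. -/

section Systems

variable {κ ι : Type}

theorem toInt_add (x y : ι → ℕ) : toInt (x + y) = toInt x + toInt y := by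
  ext i; simp [toInt]

theorem toInt_zero : toInt (0 : ι → ℕ) = 0 := by
  ext i; simp [toInt]

theorem natAbs_le_matNorm [Fintype κ] [Fintype ι] (A : Matrix κ ι ℤ) (r : κ) (i : ι) :
    (A r i).natAbs ≤ matNorm A :=
  Finset.le_sup (f := fun p : κ × ι => (A p.1 p.2).natAbs) (Finset.mem_univ (r, i))

theorem natAbs_le_vecNorm [Fintype κ] (c : κ → ℤ) (r : κ) : (c r).natAbs ≤ vecNorm c :=
  Finset.le_sup (f := fun r : κ => (c r).natAbs) (Finset.mem_univ r)

variable [Fintype ι]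

/-- The lower end of the range of `t c_r - (A f)_r` for `t ∈ [0, 1]` and `f ∈ [0, 1] ^ n`. -/
def boxLo (A : Matrix κ ι ℤ) (c : κ → ℤ) (r : κ) : ℤ := -(∑ i, max (A r i) 0) - max (-c r) 0

/-- The upper end of the range of `t c_r - (A f)_r` for `t ∈ [0, 1]` and `f ∈ [0, 1] ^ n`. -/
def boxHi (A : Matrix κ ι ℤ) (c : κ → ℤ) (r : κ) : ℤ := (∑ i, max (-A r i) 0) + max (c r) 0

theorem boxHi_sub_boxLo (A : Matrix κ ι ℤ) (c : κ → ℤ) (r : κ) :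
    boxHi A c r - boxLo A c r = ∑ i, |A r i| + |c r| := by
  have h (a : ℤ) : max (-a) 0 + max a 0 = |a| := by
    rcases le_total a 0 with h | h
    · rw [max_eq_left (by omega), max_eq_right h, abs_of_nonpos h, add_zero]
    · rw [max_eq_right (by omega), max_eq_left h, abs_of_nonneg h, zero_add]
  simp only [← h, Finset.sum_add_distrib, boxHi, boxLo]
  ring

/-- Side `r` of the box has `∑ i, |A r i| + |c r| + 1` lattice points, which is at most the base of
the power `L`. -/
theorem card_box_le [Fintype κ] (A : Matrix κ ι ℤ) (c : κ → ℤ) :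
    ∏ r, (Finset.Icc (boxLo A c r) (boxHi A c r)).card ≤ boundL A c := by
  unfold boundL
  rw [← Finset.card_univ (α := κ), ← Finset.prod_const]
  refine Finset.prod_le_prod' fun r _ => ?_
  rw [Int.card_Icc]
  have h1 := boxHi_sub_boxLo A c r
  have h2 : ∑ i, |A r i| ≤ (Fintype.card ι : ℤ) * matNorm A := by
    refine (Finset.sum_le_card_nsmul _ _ (matNorm A : ℤ) fun i _ => ?_).trans (by simp)
    rw [Int.abs_eq_natAbs]
    exact_mod_cast natAbs_le_matNorm A r i
  have h3 : |c r| ≤ vecNorm c := by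
    rw [Int.abs_eq_natAbs]
    exact_mod_cast natAbs_le_vecNorm c r
  have h4 : boxHi A c r + 1 - boxLo A c r ≤
      (((Fintype.card ι + 1) * matNorm A + vecNorm c + 1 : ℕ) : ℤ) := by
    push_cast
    nlinarith
  omega

/-- A lattice point near the segment from `0` to a solution `x` is mapped by `A` into the box. -/
theorem mulVec_floor_mem_box {A : Matrix κ ι ℤ} {c : κ → ℤ} {x : ι → ℕ}
    (hx : A.mulVec (toInt x) = c) {q j : ℕ} (hj : j < q) (r : κ) :
    A.mulVec (toInt fun i => j * x i / q) r ∈ Finset.Icc (boxLo A c r) (boxHi A c r) := by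
  have hq : (0 : ℤ) < q := by omega
  -- Rounding down leaves remainders in `[0, q]`; dividing by `q` gives `t c - A f` with `t` and the
  -- entries of `f` in `[0, 1]`.
  have key : (q : ℤ) * A.mulVec (toInt fun i => j * x i / q) r =
      j * c r - ∑ i, A r i * ((j * x i % q : ℕ) : ℤ) := by
    rw [← hx]
    simp only [Matrix.mulVec, dotProduct, toInt]
    rw [Finset.mul_sum, Finset.mul_sum, ← Finset.sum_sub_distrib]
    refine Finset.sum_congr rfl fun i _ => ?_
    have := Nat.div_add_mod (j * x i) q
    have h2 : (q : ℤ) * ((j * x i / q : ℕ) : ℤ) + ((j * x i % q : ℕ) : ℤ) = j * x i := by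
      exact_mod_cast this
    linear_combination (A r i) * h2
  have hrem (i : ι) : ((j * x i % q : ℕ) : ℤ) ≤ q := by
    exact_mod_cast (Nat.mod_lt _ (by omega)).le
  have bound (a t : ℤ) (h0 : 0 ≤ t) (h1 : t ≤ q) : a * t ≤ q * max a 0 := by
    rcases le_total a 0 with h | h
    · rw [max_eq_right h]; nlinarith
    · rw [max_eq_left h]; nlinarith
  have s1 : ∑ i, A r i * ((j * x i % q : ℕ) : ℤ) ≤ q * ∑ i, max (A r i) 0 := by
    rw [Finset.mul_sum]
    exact Finset.sum_le_sum fun i _ => bound _ _ (by positivity) (hrem i)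
  have s2 : -∑ i, A r i * ((j * x i % q : ℕ) : ℤ) ≤ q * ∑ i, max (-A r i) 0 := by
    rw [Finset.mul_sum, ← Finset.sum_neg_distrib]
    refine Finset.sum_le_sum fun i _ => ?_
    rw [← neg_mul]
    exact bound _ _ (by positivity) (hrem i)
  have c1 := bound (c r) j (by positivity) (by omega)
  have c2 := bound (-c r) j (by positivity) (by omega)
  rw [Finset.mem_Icc]
  constructor
  · refine le_of_mul_le_mul_left ?_ hq
    rw [key, boxLo, mul_sub, mul_neg]
    linarith
  · refine le_of_mul_le_mul_left ?_ hq
    rw [key, boxHi, mul_add]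
    linarith

/-- Below a solution with an entry greater than `L` lies a nonzero solution of the homogeneous
system. -/
theorem exists_homogeneous_le [Fintype κ] {A : Matrix κ ι ℤ} {c : κ → ℤ} {x : ι → ℕ}
    (hx : A.mulVec (toInt x) = c) {k : ι} (hk : boundL A c < x k) :
    ∃ d ≤ x, d ≠ 0 ∧ A.mulVec (toInt d) = 0 := by
  classical
  -- For `j < x k` these points are distinct, as the entry of `P j` at `k` is `j`. There are more
  -- than `L` of them, so two have the same image under `A`, and their difference is the vector
  -- sought.
  let P : ℕ → ι → ℕ := fun j i => j * x i / x k
  have hcard : (Fintype.piFinset fun r => Finset.Icc (boxLo A c r) (boxHi A c r)).card <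
      (Finset.range (x k)).card := by
    rw [Fintype.card_piFinset, Finset.card_range]
    exact (card_box_le A c).trans_lt hk
  obtain ⟨j, hj, j', hj', hne, heq⟩ := Finset.exists_ne_map_eq_of_card_lt_of_maps_to hcard
    (f := fun j => A.mulVec (toInt (P j))) (by
      intro j hj
      rw [Finset.mem_coe, Finset.mem_range] at hj
      rw [Finset.mem_coe, Fintype.mem_piFinset]
      exact fun r => mulVec_floor_mem_box hx hj r)
  rw [Finset.mem_range] at hj hj'
  wlog hlt : j < j' generalizing j j'
  · exact this j' hj' j hj hne.symm heq.symm (by omega)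
  have hmono : P j ≤ P j' := fun i => Nat.div_le_div_right (Nat.mul_le_mul_right _ hlt.le)
  refine ⟨P j' - P j, fun i => ?_, fun h => ?_, ?_⟩
  · refine (Nat.sub_le _ _).trans (Nat.div_le_of_le_mul ?_)
    exact Nat.mul_le_mul_right _ hj'.le
  · have := congrFun h k
    simp only [P, Pi.sub_apply, Pi.zero_apply] at this
    rw [Nat.mul_div_cancel _ (by omega), Nat.mul_div_cancel _ (by omega)] at this
    omega
  · have h1 : P j' = P j + (P j' - P j) := (add_tsub_cancel_of_le hmono).symm
    have h2 : A.mulVec (toInt (P j)) = A.mulVec (toInt (P j')) := heq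
    rw [h1, toInt_add, Matrix.mulVec_add] at h2
    exact left_eq_add.mp h2

/-- Below every solution lies a solution with entries at most `L`. -/
theorem exists_small_solution_le [Fintype κ] {A : Matrix κ ι ℤ} {c : κ → ℤ} (x : ι → ℕ)
    (hx : A.mulVec (toInt x) = c) :
    ∃ y ≤ x, A.mulVec (toInt y) = c ∧ ∀ i, y i ≤ boundL A c := by
  induction hs : ∑ i, x i using Nat.strong_induction_on generalizing x with
  | _ s ih =>
    by_cases hb : ∀ i, x i ≤ boundL A c
    · exact ⟨x, le_rfl, hx, hb⟩
    push Not at hb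
    obtain ⟨k, hk⟩ := hb
    obtain ⟨d, hd, hd0, hAd⟩ := exists_homogeneous_le hx hk
    have hsum : x = (x - d) + d := (tsub_add_cancel_of_le hd).symm
    have hx' : A.mulVec (toInt (x - d)) = c := by
      rw [hsum, toInt_add, Matrix.mulVec_add, hAd, add_zero] at hx
      exact hx
    obtain ⟨i, hi⟩ := Function.ne_iff.mp hd0
    obtain ⟨y, hy, h⟩ := ih (∑ i, (x - d) i) (by
      rw [← hs]
      refine Finset.sum_lt_sum (fun i _ => Nat.sub_le _ _) ⟨i, Finset.mem_univ _, ?_⟩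
      have hdi : d i ≤ x i := hd i
      have hi' : d i ≠ 0 := hi
      exact Nat.sub_lt (by omega) (by omega)) (x - d) hx' rfl
    exact ⟨y, hy.trans tsub_le_self, h⟩

end Systems

/-! ### Slack variables. -/

theorem LinSystem.eqA_mulVec_apply {κ ι : Type} [Fintype κ] [Fintype ι] (S : LinSystem κ ι)
    (x : ι → ℕ) (s : S.Slack → ℕ) (r : κ) :
    S.eqA.mulVec (toInt (Sum.elim x s)) r = S.A.mulVec (toInt x) r +
      if h : S.rel r ≠ Cmp.eq then (S.rel r).slackCoeff * s ⟨r, h⟩ else 0 := by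
  classical
  have hx : toInt (Sum.elim x s) = Sum.elim (toInt x) (toInt s) := by
    ext (i | i) <;> rfl
  rw [LinSystem.eqA, hx, Matrix.fromCols_mulVec, Sum.elim_comp_inl, Sum.elim_comp_inr,
    Pi.add_apply]
  congr 1
  simp only [Matrix.mulVec, dotProduct, Matrix.of_apply, ite_mul, zero_mul, toInt]
  split_ifs with h
  · rw [Finset.sum_eq_single ⟨r, h⟩]
    · simp
    · rintro ⟨b, hb⟩ _ hne
      rw [if_neg]
      rintro rfl
      exact hne rfl
    · simp
  · refine Finset.sum_eq_zero ?_
    rintro ⟨b, hb⟩ _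
    rw [if_neg]
    rintro rfl
    exact h hb

/-- The solutions of a system are those of the system of equations, without the slack part. -/
theorem LinSystem.mem_sol_iff {κ ι : Type} [Fintype κ] [Fintype ι] (S : LinSystem κ ι)
    (x : ι → ℕ) :
    x ∈ S.sol ↔ ∃ s : S.Slack → ℕ, S.eqA.mulVec (toInt (Sum.elim x s)) = S.eqC := by
  constructor
  · intro h
    -- The slack is the distance to the shifted constant; its sign is carried by `slackCoeff`.
    refine ⟨fun r => (S.A.mulVec (toInt x) r.1 - S.eqC r.1).natAbs, funext fun r => ?_⟩
    rw [LinSystem.eqA_mulVec_apply]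
    have hr := h r
    simp only [LinSystem.eqC]
    split_ifs with h0
    · cases hrel : S.rel r <;> simp only [hrel, Cmp.Holds, Cmp.slackCoeff, Cmp.shift] at hr h0 ⊢
      · exact absurd rfl h0
      all_goals omega
    · rw [not_not] at h0
      simp only [h0, Cmp.Holds, Cmp.shift] at hr ⊢
      omega
  · rintro ⟨s, hs⟩ r
    have hr := congrFun hs r
    rw [LinSystem.eqA_mulVec_apply] at hr
    simp only [LinSystem.eqC] at hr
    split_ifs at hr with h0
    · cases hrel : S.rel r <;>
        simp only [hrel, Cmp.Holds, Cmp.slackCoeff, Cmp.shift] at hr h0 ⊢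
      · exact absurd rfl h0
      all_goals omega
    · rw [not_not] at h0
      simp only [h0, Cmp.Holds, Cmp.shift] at hr ⊢
      omega

theorem exists_eq_add_single {α : Type} [DecidableEq α] {y : α → ℕ} {e : α} (he : 0 < y e) :
    ∃ z : α → ℕ, y = z + Pi.single e 1 := by
  refine ⟨y - Pi.single e 1, (tsub_add_cancel_of_le fun b => ?_).symm⟩
  by_cases hb : b = e
  · subst hb
    rw [Pi.single_eq_same]
    exact he
  · rw [Pi.single_eq_of_ne hb]
    exact Nat.zero_le _

/-! ### Flows through the automaton and their decomposition into runs. -/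

section Automaton

variable {κ ι : Type} [Fintype κ] [Fintype ι] {A : Matrix κ ι ℤ} {c : κ → ℤ}

open Classical in
/-- The Parikh vector of a multiset of transitions. -/
def parikh (y : Trans A c → ℕ) : ι → ℕ := fun i => ∑ e, if e.1.2.1 = i then y e else 0

theorem parikh_zero : parikh (0 : Trans A c → ℕ) = 0 := by
  ext i; simp [parikh]

theorem parikh_add (y z : Trans A c → ℕ) : parikh (y + z) = parikh y + parikh z := by
  ext i
  simp only [parikh, Pi.add_apply, ← Finset.sum_add_distrib]
  refine Finset.sum_congr rfl fun e _ => ?_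
  split_ifs <;> rfl

open Classical in
theorem parikh_single (e : Trans A c) :
    parikh (Pi.single e 1 : Trans A c → ℕ) = Pi.single e.1.2.1 1 := by
  ext i
  rw [parikh, Finset.sum_eq_single e]
  · simp [Pi.single_apply, eq_comm]
  · intro b _ hb
    simp [hb]
  · simp

/-- The excess of the incoming over the outgoing flow at each inner state. -/
def excess (y : Trans A c → ℕ) : State A c → ℤ := (flowMat A c).mulVec (toInt y)

theorem excess_zero : excess (0 : Trans A c → ℕ) = 0 := by
  simp [excess, toInt_zero]

theorem excess_add (y z : Trans A c → ℕ) : excess (y + z) = excess y + excess z := by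
  simp [excess, toInt_add, Matrix.mulVec_add]

open Classical in
/-- The excess of a unit of flow that ends in the state `q`. -/
def unitAt (q : State A c) : State A c → ℤ :=
  fun s => if s = State.init ∨ s = State.acc then 0 else if q = s then 1 else 0

theorem unitAt_init : unitAt (State.init : State A c) = 0 := by
  ext s
  simp only [unitAt, Pi.zero_apply]
  split_ifs with h1 h2
  · rfl
  · exact absurd (Or.inl h2.symm) h1
  · rfl

theorem unitAt_acc : unitAt (State.acc : State A c) = 0 := by
  ext s
  simp only [unitAt, Pi.zero_apply]
  split_ifs with h1 h2
  · rfl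
  · exact absurd (Or.inr h2.symm) h1
  · rfl

/-- A rank function that increases along the transitions between non-accepting states. -/
def State.rank : State A c → ℕ
  | .init => 0
  | .mid i t _ => (pos i : ℕ) * (boundL A c + 1) + t.1
  | .acc => 0

/-- The weight `L + 1` of a letter exceeds every counter value, so moving to a later letter
outweighs the reset of the counter to `1`. -/
theorem Step.rank_lt {p : State A c} {j i : ι} {t : Finset.Icc 1 (boundL A c)}
    {v : κ → Finset.Icc (-(boundD A c : ℤ)) (boundD A c : ℤ)}
    (h : Step A c p j (.mid i t v)) : p.rank < (State.mid i t v).rank := by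
  have ht := Finset.mem_Icc.mp t.2
  cases p with
  | init => simp only [State.rank]; omega
  | mid i' t' v' =>
    obtain ⟨rfl, -, h⟩ := h
    have ht' := Finset.mem_Icc.mp t'.2
    simp only [State.rank]
    rcases h with ⟨rfl, h⟩ | ⟨h, h1⟩
    · omega
    · have h : (pos i' : ℕ) + 1 ≤ pos i := h
      have := Nat.mul_le_mul_right (boundL A c + 1) h
      rw [Nat.add_mul] at this
      omega
  | acc => exact h.elim

theorem Step.src_ne_acc {p q : State A c} {j : ι} (h : Step A c p j q) : p ≠ .acc := by
  rintro rfl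
  exact h

theorem Step.tgt_ne_init {p q : State A c} {j : ι} (h : Step A c p j q) : q ≠ .init := by
  rintro rfl
  cases p <;> exact h

theorem Step.src_ne_tgt {p q : State A c} {j : ι} (h : Step A c p j q) : p ≠ q := by
  rintro rfl
  cases p with
  | init => exact h
  | mid i t v => exact absurd h.rank_lt (lt_irrefl _)
  | acc => exact h

theorem flowMat_apply (q : State A c) (e : Trans A c) :
    flowMat A c q e = unitAt e.1.2.2 q - unitAt e.1.1 q := by
  simp only [flowMat, unitAt, Matrix.of_apply]
  have hne := e.2.src_ne_tgt
  split_ifs with h1 h2 h3 h3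
  · rfl
  · exact absurd (h3.trans h2.symm) hne
  all_goals rfl

open Classical in
theorem excess_single (e : Trans A c) :
    excess (Pi.single e 1 : Trans A c → ℕ) = unitAt e.1.2.2 - unitAt e.1.1 := by
  ext q
  have h : toInt (Pi.single e 1 : Trans A c → ℕ) = Pi.single e 1 := by
    ext b
    simp [toInt, Pi.single_apply]
  rw [excess, h, Matrix.mulVec_single_one, Matrix.col_apply, flowMat_apply, Pi.sub_apply]

/-- A flow that leaves more than it enters uses a transition leaving the state. -/
theorem exists_pos_of_excess_neg {y : Trans A c → ℕ} {q : State A c} (h : excess y q < 0) :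
    ∃ e, 0 < y e ∧ e.1.1 = q := by
  obtain ⟨e, -, he⟩ := Finset.exists_lt_of_sum_lt
    (show ∑ e, flowMat A c q e * (y e : ℤ) < ∑ e : Trans A c, 0 by
      rw [Finset.sum_const_zero]; exact h)
  refine ⟨e, Nat.pos_of_ne_zero fun h0 => ?_, by_contra fun hq => ?_⟩
  · simp [h0] at he
  · refine absurd he (not_lt.mpr (mul_nonneg ?_ (Int.natCast_nonneg _)))
    simp only [flowMat, Matrix.of_apply, if_neg hq]
    split_ifs <;> simp

/-- A conserved flow that leaves an inner state enters it. -/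
theorem exists_pos_of_excess_eq_zero {y : Trans A c → ℕ} (h : excess y = 0) {e : Trans A c}
    (he : 0 < y e) (hinit : e.1.1 ≠ .init) : ∃ e', 0 < y e' ∧ e'.1.2.2 = e.1.1 := by
  by_contra! hall
  have hz : ∑ e', flowMat A c e.1.1 e' * (y e' : ℤ) = 0 := congrFun h e.1.1
  have hle (e' : Trans A c) : flowMat A c e.1.1 e' * (y e' : ℤ) ≤ 0 := by
    rcases Nat.eq_zero_or_pos (y e') with h0 | h0
    · simp [h0]
    · refine mul_nonpos_of_nonpos_of_nonneg ?_ (Int.natCast_nonneg _)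
      simp only [flowMat, Matrix.of_apply, if_neg (hall e' h0)]
      split_ifs <;> simp
  -- If nothing enters the state, all terms of the balance are nonpositive, so each vanishes; but
  -- the term of `e` is `-y e < 0`.
  have := (Finset.sum_eq_zero_iff_of_nonpos fun e' _ => hle e').mp hz e (Finset.mem_univ _)
  rw [flowMat_apply] at this
  simp only [unitAt, hinit, e.2.src_ne_acc, e.2.src_ne_tgt.symm, or_self, if_false, if_true]
    at this
  omega

/-- A nonzero conserved flow leaves the initial state. -/
theorem exists_pos_src_init {y : Trans A c → ℕ} (h : excess y = 0) (hy : y ≠ 0) :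
    ∃ e, 0 < y e ∧ e.1.1 = .init := by
  obtain ⟨e₀, he₀⟩ := Function.ne_iff.mp hy
  -- Trace the flow backwards: a source other than the initial state is entered from a state of
  -- smaller rank.
  induction hr : (e₀.1.1).rank using Nat.strong_induction_on generalizing e₀ with
  | _ k ih =>
    by_cases hi : e₀.1.1 = .init
    · exact ⟨e₀, Nat.pos_of_ne_zero he₀, hi⟩
    obtain ⟨e, he, heq⟩ := exists_pos_of_excess_eq_zero h (Nat.pos_of_ne_zero he₀) hi
    refine ih _ ?_ e he.ne' rfl
    have hs := e.2
    have hacc := e₀.2.src_ne_acc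
    rw [← hr]
    rw [heq] at hs
    cases hq : e₀.1.1 with
    | init => exact absurd hq hi
    | mid i t v =>
      rw [hq] at hs
      exact hs.rank_lt
    | acc => exact absurd hq hacc

/-- `p` may be the Parikh vector of a word that leads to the state `q`. -/
def Fits (A : Matrix κ ι ℤ) (c : κ → ℤ) (p : ι → ℕ) : State A c → Prop
  | .init => p = 0
  | .mid _ _ v => ∀ r, (v r).1 = A.mulVec (toInt p) r
  | .acc => A.mulVec (toInt p) = c

open Classical in
omit [Fintype κ] in
theorem mulVec_add_single (A : Matrix κ ι ℤ) (p : ι → ℕ) (j : ι) (r : κ) :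
    A.mulVec (toInt (p + Pi.single j 1)) r = A.mulVec (toInt p) r + A r j := by
  have h : toInt (Pi.single j 1 : ι → ℕ) = Pi.single j 1 := by
    ext b
    simp [toInt, Pi.single_apply]
  rw [toInt_add, Matrix.mulVec_add, h, Matrix.mulVec_single_one, Pi.add_apply, Matrix.col_apply]

-- This invariant makes every word that reaches the accepting state a solution.
open Classical in
theorem Step.fits {p : ι → ℕ} {q q' : State A c} {j : ι} (h : Step A c q j q')
    (hp : Fits A c p q) : Fits A c (p + Pi.single j 1) q' := by
  cases q with
  | init =>
    obtain rfl : p = 0 := hp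
    cases q' with
    | init => exact h.elim
    | mid i t v =>
      intro r
      rw [mulVec_add_single, h.2.2 r, toInt_zero, Matrix.mulVec_zero, Pi.zero_apply, zero_add]
    | acc =>
      ext r
      rw [mulVec_add_single, h r, toInt_zero, Matrix.mulVec_zero, Pi.zero_apply, zero_add]
  | mid i t v =>
    cases q' with
    | init => exact h.elim
    | mid i' t' v' =>
      intro r
      rw [mulVec_add_single, h.2.1 r, hp r]
    | acc =>
      ext r
      rw [mulVec_add_single, ← h.1 r, hp r]
  | acc => exact h.elim

/-- Decomposition of a flow: a run that has reached the state `q` with the Parikh vector `p` is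
continued along a flow in which a unit starts at `q`. -/
theorem exists_list_of_excess (y : Trans A c → ℕ) (q : State A c) (p : ι → ℕ)
    (hq : q ≠ .init) (hp : Fits A c p q) (hy : excess y = -unitAt q) :
    ∃ l : List (ι → ℕ), l ≠ [] ∧ (∀ b ∈ l, A.mulVec (toInt b) = c) ∧
      l.sum = p + parikh y := by
  classical
  induction hs : ∑ e, y e using Nat.strong_induction_on generalizing y q p with
  | _ k ih =>
    have remove (e : Trans A c) (he : 0 < y e) :
        ∃ z : Trans A c → ℕ, y = z + Pi.single e 1 ∧ ∑ e, z e < k := by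
      obtain ⟨z, rfl⟩ := exists_eq_add_single he
      exact ⟨z, rfl, by simp [← hs, Finset.sum_add_distrib]⟩
    cases q with
    | init => exact absurd rfl hq
    | mid i t v =>
      obtain ⟨e, he, hsrc⟩ := exists_pos_of_excess_neg (y := y) (q := .mid i t v)
        (by simp [hy, unitAt])
      obtain ⟨z, rfl, hz⟩ := remove e he
      rw [excess_add, excess_single, hsrc] at hy
      obtain ⟨l, hl, hsol, hsum⟩ := ih _ hz z e.1.2.2 (p + Pi.single e.1.2.1 1)
        e.2.tgt_ne_init (e.2.fits (hsrc ▸ hp))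
        (by linear_combination (exp := 1) hy) rfl
      exact ⟨l, hl, hsol, by rw [hsum, parikh_add, parikh_single]; abel⟩
    | acc =>
      rw [unitAt_acc, neg_zero] at hy
      -- At the accepting state the word `p` is complete. The remaining flow is conserved, so unless
      -- it is zero it starts another word at the initial state.
      by_cases h0 : y = 0
      · exact ⟨[p], by simp, by simpa using (show A.mulVec (toInt p) = c from hp),
          by simp [h0, parikh_zero]⟩
      obtain ⟨e, he, hsrc⟩ := exists_pos_src_init hy h0
      obtain ⟨z, rfl, hz⟩ := remove e he
      rw [excess_add, excess_single, hsrc, unitAt_init] at hy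
      obtain ⟨l, hl, hsol, hsum⟩ := ih _ hz z e.1.2.2 (0 + Pi.single e.1.2.1 1)
        e.2.tgt_ne_init (e.2.fits (hsrc ▸ rfl))
        (by linear_combination (exp := 1) hy) rfl
      refine ⟨p :: l, by simp, ?_, ?_⟩
      · rintro b (_ | ⟨_, hb⟩)
        · exact hp
        · exact hsol b hb
      · rw [List.sum_cons, hsum, parikh_add, parikh_single]
        abel

/-! ### Small solutions as unit flows. -/

/-- There is a unit of flow from the initial state to `q` with Parikh vector `p`. -/
def Reach (A : Matrix κ ι ℤ) (c : κ → ℤ) (q : State A c) (p : ι → ℕ) : Prop :=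
  ∃ f : Trans A c → ℕ, excess f = unitAt q ∧ parikh f = p

theorem reach_init : Reach A c .init 0 := ⟨0, by rw [excess_zero, unitAt_init], parikh_zero⟩

open Classical in
theorem Reach.step {q q' : State A c} {p : ι → ℕ} {j : ι} (h : Reach A c q p)
    (hs : Step A c q j q') : Reach A c q' (p + Pi.single j 1) := by
  obtain ⟨f, hf, rfl⟩ := h
  refine ⟨f + Pi.single ⟨(q, j, q'), hs⟩ 1, ?_, ?_⟩
  · rw [excess_add, excess_single, hf]
    abel
  · rw [parikh_add, parikh_single]

/-- The bound `D` is chosen so that partial sums along such words never leave the state space. -/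
theorem mulVec_bound {p : ι → ℕ} (hp : ∀ i, p i ≤ boundL A c) (r : κ) :
    A.mulVec (toInt p) r ∈ Finset.Icc (-(boundD A c : ℤ)) (boundD A c : ℤ) := by
  rw [Finset.mem_Icc, ← abs_le]
  calc |A.mulVec (toInt p) r| ≤ ∑ i, |A r i * (p i : ℤ)| := Finset.abs_sum_le_sum_abs _ _
    _ ≤ ∑ _i : ι, (matNorm A * boundL A c : ℤ) := by
        refine Finset.sum_le_sum fun i _ => ?_
        rw [abs_mul, Nat.abs_cast, Int.abs_eq_natAbs]
        exact_mod_cast Nat.mul_le_mul (natAbs_le_matNorm A r i) (hp i)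
    _ = boundD A c := by simp [boundD, mul_assoc]

open Classical in
/-- The word with Parikh vector `p` can be read up to its last letter `i`. -/
def ReadsButLast (A : Matrix κ ι ℤ) (c : κ → ℤ) (p : ι → ℕ) (i : ι) : Prop :=
  ∃ (p' : ι → ℕ) (q : State A c), p = p' + Pi.single i 1 ∧ (∀ j, pos i < pos j → p j = 0) ∧
    Reach A c q p' ∧
    ((q = .init ∧ p' = 0) ∨ ∃ i' t v, q = .mid i' t v ∧
      (∀ r, (v r).1 = A.mulVec (toInt p') r) ∧
      ((i' = i ∧ t.1 + 1 = p i) ∨ (pos i' < pos i ∧ p i = 1)))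

theorem ReadsButLast.pos_apply {p : ι → ℕ} {i : ι} (h : ReadsButLast A c p i) : 0 < p i := by
  obtain ⟨p', q, rfl, -⟩ := h
  simp

/-- The last letter may lead to an inner state or to the accepting state; stopping just before it
lets one induction serve both this lemma and `ReadsButLast.reach_acc`. -/
theorem ReadsButLast.reach_mid {p : ι → ℕ} {i : ι} (h : ReadsButLast A c p i)
    (hp : ∀ i, p i ≤ boundL A c) :
    Reach A c (.mid i ⟨p i, Finset.mem_Icc.mpr ⟨h.pos_apply, hp i⟩⟩
      fun r => ⟨_, mulVec_bound hp r⟩) p := by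
  classical
  have hpos := h.pos_apply
  obtain ⟨p', q, heq, -, hr, ⟨rfl, rfl⟩ | ⟨i', t, v, rfl, hv, hi⟩⟩ := h
  · have hs : Step A c .init i (.mid i ⟨p i, Finset.mem_Icc.mpr ⟨hpos, hp i⟩⟩
        fun r => ⟨_, mulVec_bound hp r⟩) := by
      refine ⟨rfl, by simp [heq], fun r => ?_⟩
      simp only [heq]
      rw [mulVec_add_single, toInt_zero, Matrix.mulVec_zero, Pi.zero_apply, zero_add]
    have := hr.step hs
    rwa [← heq] at this
  · have hs : Step A c (.mid i' t v) i (.mid i ⟨p i, Finset.mem_Icc.mpr ⟨hpos, hp i⟩⟩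
        fun r => ⟨_, mulVec_bound hp r⟩) := by
      refine ⟨rfl, fun r => ?_, ?_⟩
      · rw [hv r, ← mulVec_add_single, ← heq]
      · rcases hi with ⟨h1, h2⟩ | h
        · exact Or.inl ⟨h1, h2.symm⟩
        · exact Or.inr h
    have := hr.step hs
    rwa [← heq] at this

theorem ReadsButLast.reach_acc {p : ι → ℕ} {i : ι} (h : ReadsButLast A c p i)
    (hp : ∀ i, p i ≤ boundL A c) (hsol : A.mulVec (toInt p) = c) : Reach A c .acc p := by
  classical
  obtain ⟨p', q, heq, -, hr, ⟨rfl, rfl⟩ | ⟨i', t, v, rfl, hv, hi⟩⟩ := h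
  · have hs : Step A c .init i .acc := by
      intro r
      rw [← hsol, heq, mulVec_add_single, toInt_zero, Matrix.mulVec_zero, Pi.zero_apply, zero_add]
    have := hr.step hs
    rwa [← heq] at this
  · have hs : Step A c (.mid i' t v) i .acc := by
      refine ⟨fun r => ?_, ?_⟩
      · rw [hv r, ← mulVec_add_single, ← heq, hsol]
      · rcases hi with ⟨h1, h2⟩ | h
        · exact Or.inl ⟨h1, h2 ▸ hp i⟩
        · exact Or.inr h.1
    have := hr.step hs
    rwa [← heq] at this

/-- Induction on the length of the word: remove one occurrence of the largest letter and read the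
rest to its inner state. -/
theorem exists_readsButLast (p : ι → ℕ) (hp0 : p ≠ 0) (hp : ∀ i, p i ≤ boundL A c) :
    ∃ i, ReadsButLast A c p i := by
  classical
  induction hs : ∑ i, p i using Nat.strong_induction_on generalizing p with
  | _ k ih =>
    obtain ⟨i₀, hi₀⟩ := Function.ne_iff.mp hp0
    obtain ⟨i, hi, hmax⟩ := Finset.exists_max_image (Finset.univ.filter fun i => p i ≠ 0) pos
      ⟨i₀, by simpa using hi₀⟩
    replace hi : p i ≠ 0 := by simpa using hi
    have hmax (j : ι) (hj : pos i < pos j) : p j = 0 := by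
      by_contra h
      exact absurd (hmax j (by simpa using h)) (not_le.mpr hj)
    obtain ⟨p', rfl⟩ := exists_eq_add_single (Nat.pos_of_ne_zero hi)
    refine ⟨i, ?_⟩
    by_cases h0 : p' = 0
    · exact ⟨p', .init, rfl, hmax, h0 ▸ reach_init, Or.inl ⟨rfl, h0⟩⟩
    have hp' (j : ι) : p' j ≤ boundL A c := le_trans (by simp) (hp j)
    obtain ⟨i', hi'⟩ := ih (∑ i, p' i) (by simp [← hs, Finset.sum_add_distrib]) p' h0 hp' rfl
    refine ⟨p', _, rfl, hmax, hi'.reach_mid hp', Or.inr ⟨_, _, _, rfl, fun r => rfl, ?_⟩⟩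
    -- Here `i'` is the last letter of `p'`: either `i` opens a new block, or it extends the block
    -- of `i'`, or the maximality of `i` is violated.
    rcases lt_trichotomy (pos i') (pos i) with h | h | h
    · refine Or.inr ⟨h, ?_⟩
      obtain ⟨_, _, _, hz, -⟩ := hi'
      simp [hz i h]
    · obtain rfl : i' = i := (Fintype.equivFin ι).injective h
      simp
    · have h1 := hmax i' h
      have h2 := hi'.pos_apply
      simp only [Pi.add_apply] at h1
      omega

/-! ### The Kleene star of the solution set. -/

theorem labelMat_mulVec (y : Trans A c → ℕ) :
    (labelMat A c).mulVec (toInt y) = toInt (parikh y) := by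
  ext i
  simp [labelMat, Matrix.mulVec, dotProduct, toInt, parikh]

theorem tildeA_mulVec_eq_zero_iff (y : ι ⊕ Trans A c → ℕ) :
    (tildeA A c).mulVec (toInt y) = 0 ↔
      y ∘ Sum.inl = parikh (y ∘ Sum.inr) ∧ excess (y ∘ Sum.inr) = 0 := by
  classical
  have h1 : toInt y ∘ Sum.inl = toInt (y ∘ Sum.inl) := rfl
  have h2 : toInt y ∘ Sum.inr = toInt (y ∘ Sum.inr) := rfl
  rw [tildeA, Matrix.fromBlocks_mulVec, h1, h2, labelMat_mulVec, Matrix.zero_mulVec, zero_add,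
    Matrix.neg_mulVec, Matrix.one_mulVec, ← Sum.elim_zero_zero, Sum.elim_eq_iff,
    neg_add_eq_zero]
  refine and_congr ⟨fun h => funext fun i => ?_, fun h => by rw [h]⟩ Iff.rfl
  exact Int.ofNat.inj (congrFun h i)

theorem TildeSol.exists_list {x : ι → ℕ} (h : TildeSol A c x) :
    ∃ l : List (ι → ℕ), (∀ b ∈ l, A.mulVec (toInt b) = c) ∧ l.sum = x := by
  classical
  obtain ⟨y₁, y₂, hx, h1, h2, h0⟩ := h
  obtain ⟨hinl, hex⟩ := (tildeA_mulVec_eq_zero_iff y₁).mp h1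
  have hx : x = parikh (y₁ ∘ Sum.inr) + y₂ := by
    rw [← hinl]; exact funext hx
  by_cases hy : y₁ ∘ Sum.inr = 0
  · refine ⟨[], by simp, ?_⟩
    rw [hy, parikh_zero] at hinl
    have : y₁ = 0 := by
      ext (i | e)
      · exact congrFun hinl i
      · exact congrFun hy e
    rw [hx, hy, parikh_zero, h0 this, add_zero, List.sum_nil]
  · obtain ⟨e, he, hsrc⟩ := exists_pos_src_init hex hy
    generalize y₁ ∘ Sum.inr = y at *
    obtain ⟨z, rfl⟩ := exists_eq_add_single he
    rw [excess_add, excess_single, hsrc, unitAt_init] at hex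
    obtain ⟨l, hl, hsol, hsum⟩ := exists_list_of_excess z e.1.2.2 (0 + Pi.single e.1.2.1 1)
      e.2.tgt_ne_init (e.2.fits (hsrc ▸ rfl)) (by linear_combination (exp := 1) hex)
    -- The decomposition is nonempty because the flow is; its first solution absorbs the homogeneous
    -- part `y₂`.
    cases l with
    | nil => exact absurd rfl hl
    | cons b l =>
      refine ⟨(b + y₂) :: l, ?_, ?_⟩
      · rintro b' (_ | ⟨_, hb⟩)
        · rw [toInt_add, Matrix.mulVec_add, h2, add_zero]
          exact hsol b (by simp)
        · exact hsol b' (List.mem_cons_of_mem _ hb)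
      · rw [List.sum_cons] at hsum ⊢
        rw [add_right_comm, hsum, hx, parikh_add, parikh_single]
        abel

theorem TildeSol.zero : TildeSol A c 0 :=
  ⟨0, 0, by simp, by simp [toInt_zero], by simp [toInt_zero], fun _ => rfl⟩

theorem TildeSol.add {x x' : ι → ℕ} (h : TildeSol A c x) (h' : TildeSol A c x') :
    TildeSol A c (x + x') := by
  obtain ⟨y₁, y₂, hx, h1, h2, h0⟩ := h
  obtain ⟨y₁', y₂', hx', h1', h2', h0'⟩ := h'
  refine ⟨y₁ + y₁', y₂ + y₂', fun i => ?_, ?_, ?_, fun h => ?_⟩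
  · simp only [Pi.add_apply, hx, hx']
    omega
  · rw [toInt_add, Matrix.mulVec_add, h1, h1', add_zero]
  · rw [toInt_add, Matrix.mulVec_add, h2, h2', add_zero]
  -- Natural vectors with sum zero are zero, so the implication survives addition.
  · obtain ⟨ha, hb⟩ := add_eq_zero.mp h
    rw [h0 ha, h0' hb, add_zero]

/-- A small solution `p` below `x` becomes a flow and `x - p` becomes `y₂`. The automaton does not
accept the empty word, so `p ≠ 0` is needed; this is where `c ≠ 0` enters. -/
theorem tildeSol_of_mulVec_eq (hc : c ≠ 0) {x : ι → ℕ} (hx : A.mulVec (toInt x) = c) :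
    TildeSol A c x := by
  obtain ⟨p, hle, hsol, hp⟩ := exists_small_solution_le x hx
  have hp0 : p ≠ 0 := by
    rintro rfl
    rw [toInt_zero, Matrix.mulVec_zero] at hsol
    exact hc hsol.symm
  obtain ⟨i, hi⟩ := exists_readsButLast p hp0 hp
  obtain ⟨f, hf, hfp⟩ := hi.reach_acc hp hsol
  have hxp : x = p + (x - p) := (add_tsub_cancel_of_le hle).symm
  refine ⟨Sum.elim p f, x - p, fun i => congrFun hxp i, ?_, ?_, fun h => ?_⟩
  · rw [tildeA_mulVec_eq_zero_iff, Sum.elim_comp_inl, Sum.elim_comp_inr, hf, unitAt_acc]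
    exact ⟨hfp.symm, rfl⟩
  · rw [hxp, toInt_add, Matrix.mulVec_add, hsol] at hx
    exact left_eq_add.mp hx.symm
  · exact absurd (funext fun i => congrFun h (Sum.inl i)) hp0

/-- The system `TildeSol` describes the Kleene star of the set of solutions. -/
theorem tildeSol_iff_exists_list (hc : c ≠ 0) (x : ι → ℕ) :
    TildeSol A c x ↔
      ∃ l : List (ι → ℕ), (∀ b ∈ l, A.mulVec (toInt b) = c) ∧ l.sum = x := by
  refine ⟨TildeSol.exists_list, ?_⟩
  rintro ⟨l, hl, rfl⟩
  induction l with
  | nil => exact TildeSol.zero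
  | cons b l ih =>
    rw [List.sum_cons]
    exact (tildeSol_of_mulVec_eq hc (hl b (by simp))).add (ih fun b' hb => hl b' (by simp [hb]))

end Automaton

/-- The Kleene star of the set of solutions of a system with inequalities that `0` does not
solve. -/
theorem LinSystem.tildeSol_iff_exists_list {κ ι : Type} [Fintype κ] [Fintype ι]
    (S : LinSystem κ ι) (h0 : (0 : ι → ℕ) ∉ S.sol) (x : ι → ℕ) :
    S.TildeSol x ↔ ∃ l : List (ι → ℕ), (∀ b ∈ l, b ∈ S.sol) ∧ l.sum = x := by
  -- If the right-hand side vanished, `0` with zero slacks would be a solution.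
  have hc : S.eqC ≠ 0 := by
    intro hc
    refine h0 ((S.mem_sol_iff 0).mpr ⟨0, ?_⟩)
    have : (Sum.elim 0 0 : ι ⊕ S.Slack → ℕ) = 0 := Sum.elim_zero_zero
    rw [this, toInt_zero, Matrix.mulVec_zero, hc]
  constructor
  · rintro ⟨s, hs⟩
    obtain ⟨l, hl, hsum⟩ := (GP2.tildeSol_iff_exists_list hc _).mp hs
    refine ⟨l.map (· ∘ Sum.inl), ?_, ?_⟩
    · rintro _ hb'
      obtain ⟨b, hb, rfl⟩ := List.mem_map.mp hb'
      refine (S.mem_sol_iff _).mpr ⟨b ∘ Sum.inr, ?_⟩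
      rw [Sum.elim_comp_inl_inr]
      exact hl b hb
    · ext i
      have h1 := congrFun hsum (Sum.inl i)
      rw [Sum.elim_inl, Pi.list_sum_apply] at h1
      rw [Pi.list_sum_apply, List.map_map, ← h1]
      rfl
  · rintro ⟨l, hl, rfl⟩
    induction l with
    | nil =>
      refine ⟨0, ?_⟩
      have : (Sum.elim 0 0 : ι ⊕ S.Slack → ℕ) = 0 := Sum.elim_zero_zero
      rw [List.sum_nil, this]
      exact TildeSol.zero
    | cons b l ih =>
      obtain ⟨s, hs⟩ := ih fun b' hb => hl b' (by simp [hb])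
      obtain ⟨s', hs'⟩ := (S.mem_sol_iff b).mp (hl b (by simp))
      refine ⟨s' + s, ?_⟩
      have hsum : Sum.elim (b + l.sum) (s' + s) = Sum.elim b s' + Sum.elim l.sum s := by
        ext (i | i) <;> rfl
      rw [List.sum_cons, hsum]
      exact (tildeSol_of_mulVec_eq hc hs').add hs

/-! ### Behavior vectors as solutions of the characteristic system. -/

variable {n m : ℕ}

namespace NormalForm

theorem mem_behaviors_iff (φ : NormalForm n m) (π : OneTp n m) (b : AudTp m × OneTp n m → ℕ) :
    b ∈ φ.behaviors π ↔
      (∀ q : AudTp m × OneTp n m, ¬ (φ.Compat₁ q.2 ∧ φ.Compat₂ π q.1.1 q.2) → b q = 0) ∧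
      ∀ i, π.1 i = true → (φ.rel i).Holds
        (∑ t, φ.coeff i t *
          ((∑ q : AudTp m × OneTp n m, if q.1.1.1 t = true then b q else 0 : ℕ) : ℤ))
        (φ.δ i) := by
  classical
  have h1 (p : {p : AudTp m × OneTp n m // ¬ (φ.Compat₁ p.2 ∧ φ.Compat₂ π p.1.1 p.2)}) :
      (φ.charSystem π).A.mulVec (toInt b) (.inl p) = b p.1 := by
    simp [charSystem, Matrix.mulVec, dotProduct, toInt]
  have h2 (i : {i : Fin n // π.1 i = true}) :
      (φ.charSystem π).A.mulVec (toInt b) (.inr i) =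
        ∑ t, φ.coeff i.1 t *
          ((∑ q : AudTp m × OneTp n m, if q.1.1.1 t = true then b q else 0 : ℕ) : ℤ) := by
    simp only [charSystem, Matrix.mulVec, dotProduct, toInt, Matrix.of_apply, Finset.sum_mul]
    rw [Finset.sum_comm]
    refine Finset.sum_congr rfl fun t _ => ?_
    push_cast
    rw [Finset.mul_sum]
    refine Finset.sum_congr rfl fun q _ => ?_
    split_ifs <;> simp
  constructor
  · intro h
    refine ⟨fun q hq => ?_, fun i hi => ?_⟩
    · have : (φ.charSystem π).A.mulVec (toInt b) (.inl ⟨q, hq⟩) = 0 := h (.inl ⟨q, hq⟩)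
      rw [h1] at this
      exact_mod_cast this
    · have := h (.inr ⟨i, hi⟩)
      rw [h2] at this
      exact this
  · rintro ⟨ha, hb⟩ (p | i)
    · have : (φ.charSystem π).A.mulVec (toInt b) (.inl p) = 0 := by
        rw [h1, ha p.1 p.2, Nat.cast_zero]
      exact this
    · rw [h2]
      exact hb i.1 i.2

end NormalForm

/-! ### Quantifier-free formulas and atomic types. -/

section Realize

variable {M N : Type} [(voc n m).Structure M] [(voc n m).Structure N]

theorem exists_term_eq_var {α : Type} (t : (voc n m).Term α) : ∃ i, t = .var i := by
  cases t with
  | var i => exact ⟨i, rfl⟩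
  | func f _ => exact (f : Empty).elim

/-- The truth of a quantifier-free formula depends only on the atomic type of the tuple. -/
theorem realize_iff_of_isQF {k : ℕ} {ψ : (voc n m).Formula (Fin k)} (hψ : ψ.IsQF)
    {v : Fin k → M} {w : Fin k → N} (heq : ∀ i j, v i = v j ↔ w i = w j)
    (hU : ∀ (u : Fin n) i, HoldsU (m := m) u (v i) ↔ HoldsU (m := m) u (w i))
    (hR : ∀ (t : Fin m) i j, HoldsR (n := n) t (v i) (v j) ↔ HoldsR (n := n) t (w i) (w j)) :
    ψ.Realize v ↔ ψ.Realize w := by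
  have vars (t : (voc n m).Term (Fin k ⊕ Fin 0)) : ∃ i, t = .var (.inl i) := by
    obtain ⟨i | i, rfl⟩ := exists_term_eq_var t
    · exact ⟨i, rfl⟩
    · exact i.elim0
  unfold FirstOrder.Language.Formula.Realize
  induction hψ with
  | falsum => exact Iff.rfl
  | of_isAtomic h =>
    cases h with
    | equal t₁ t₂ =>
      obtain ⟨i, rfl⟩ := vars t₁
      obtain ⟨j, rfl⟩ := vars t₂
      simpa using heq i j
    | rel R ts =>
      cases R with
      | U u =>
        obtain ⟨i, hi⟩ := vars (ts 0)
        have key (K : Type) [(voc n m).Structure K] (z : Fin k → K) :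
            (FirstOrder.Language.Relations.boundedFormula (L := voc n m) (Pred.U u) ts).Realize
              z default ↔ HoldsU (m := m) u (z i) := by
          rw [FirstOrder.Language.BoundedFormula.realize_rel, HoldsU]
          have : (fun l => (ts l).realize (Sum.elim z default)) = ![z i] := by
            ext l
            fin_cases l
            simp [hi]
          rw [this]
        exact (key M v).trans ((hU u i).trans (key N w).symm)
      | R t =>
        obtain ⟨i, hi⟩ := vars (ts 0)
        obtain ⟨j, hj⟩ := vars (ts 1)
        have key (K : Type) [(voc n m).Structure K] (z : Fin k → K) :
            (FirstOrder.Language.Relations.boundedFormula (L := voc n m) (Pred.R t) ts).Realize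
              z default ↔ HoldsR (n := n) t (z i) (z j) := by
          rw [FirstOrder.Language.BoundedFormula.realize_rel, HoldsR]
          have : (fun l => (ts l).realize (Sum.elim z default)) = ![z i, z j] := by
            ext l
            fin_cases l
            · simp [hi]
            · simp [hj]
          rw [this]
        exact (key M v).trans ((hR t i j).trans (key N w).symm)
  | imp _ _ ih₁ ih₂ =>
    exact imp_congr ih₁ ih₂

end Realize

/-! ### From a finite model to a solution of `Q`. -/

section Model

open Classical in
/-- The 1-type of an element. -/
def oneTp (n m : ℕ) {M : Type} [(voc n m).Structure M] (a : M) : OneTp n m :=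
  (fun i => decide (HoldsU (m := m) i a), fun i => decide (HoldsR (n := n) i a a))

open Classical in
/-- The 2-type of a pair of elements. -/
def twoTp (n m : ℕ) {M : Type} [(voc n m).Structure M] (a b : M) : TwoTp m :=
  (fun i => decide (HoldsR (n := n) i a b), fun i => decide (HoldsR (n := n) i b a))

variable {M : Type} [(voc n m).Structure M]

theorem hasOneTp_oneTp (a : M) : HasOneTp a (oneTp n m a) := by
  simp [HasOneTp, oneTp]

theorem hasTwoTp_twoTp (a b : M) : HasTwoTp n a b (twoTp n m a b) := by
  simp [HasTwoTp, twoTp]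

theorem dual_twoTp (a b : M) : dual (twoTp n m a b) = twoTp n m b a := rfl

/-- Entailment by a type quantifies over all finite structures, but a quantifier-free formula true
at one realization of the type is true at all of them. -/
theorem NormalForm.Models.compat₁ {φ : NormalForm n m} [Finite M] (h : φ.Models M) (a : M) :
    φ.Compat₁ (oneTp n m a) := by
  intro N _ _ b hb
  have ha := hasOneTp_oneTp (n := n) (m := m) a
  refine (realize_iff_of_isQF φ.γ_qf ?_ ?_ ?_).mp (h.1 a)
  · intro i j
    simp [Subsingleton.elim i j]
  · intro u i
    rw [Subsingleton.elim i 0]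
    exact (ha.1 u).symm.trans (hb.1 u)
  · intro t i j
    rw [Subsingleton.elim i 0, Subsingleton.elim j 0]
    exact (ha.2 t).symm.trans (hb.2 t)

theorem NormalForm.Models.entails₂ {φ : NormalForm n m} [Finite M] (h : φ.Models M) {a b : M}
    (hab : a ≠ b) : φ.Entails₂ (oneTp n m a) (twoTp n m a b) (oneTp n m b) := by
  intro N _ _ a' b' ha' hab' hb' r hr
  have ha := hasOneTp_oneTp (n := n) (m := m) a
  have hb := hasOneTp_oneTp (n := n) (m := m) b
  have h2 := hasTwoTp_twoTp (n := n) (m := m) a b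
  refine (realize_iff_of_isQF (φ.α_qf r) ?_ ?_ ?_).mp
    (h.2.1 r a b ⟨(h2.1 r).mp ((hab'.1 r).mpr hr.1), hab⟩)
  · have := hr.2
    intro i j
    fin_cases i <;> fin_cases j <;> simp [hab, this, hab.symm, this.symm]
  · intro u i
    fin_cases i
    · exact (ha.1 u).symm.trans (ha'.1 u)
    · exact (hb.1 u).symm.trans (hb'.1 u)
  · intro t i j
    fin_cases i <;> fin_cases j
    · exact (ha.2 t).symm.trans (ha'.2 t)
    · exact (h2.1 t).symm.trans (hab'.1 t)
    · exact (h2.2 t).symm.trans (hab'.2 t)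
    · exact (hb.2 t).symm.trans (hb'.2 t)

theorem NormalForm.Models.compat₂ {φ : NormalForm n m} [Finite M] (h : φ.Models M) {a b : M}
    (hab : a ≠ b) : φ.Compat₂ (oneTp n m a) (twoTp n m a b) (oneTp n m b) :=
  ⟨h.entails₂ hab, h.entails₂ hab.symm⟩

variable [Fintype M]

open Classical in
/-- The numbers of neighbors of an element, by 2-type and 1-type of the neighbor. -/
def behavior (n m : ℕ) {M : Type} [(voc n m).Structure M] [Fintype M] (a : M) :
    AudTp m × OneTp n m → ℕ :=
  fun q => ∑ b, if a ≠ b ∧ twoTp n m a b = q.1.1 ∧ oneTp n m b = q.2 then 1 else 0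

open Classical in
theorem card_successors (a : M) (t : Fin m) :
    Nat.card {b : M // HoldsR (n := n) t a b ∧ a ≠ b} =
      ∑ q : AudTp m × OneTp n m, if q.1.1.1 t = true then behavior n m a q else 0 := by
  rw [Nat.card_eq_fintype_card, Fintype.card_subtype, Finset.card_filter]
  simp only [behavior]
  have (q : AudTp m × OneTp n m) : (if q.1.1.1 t = true then
      ∑ b, (if a ≠ b ∧ twoTp n m a b = q.1.1 ∧ oneTp n m b = q.2 then 1 else 0) else 0) =
      ∑ b, if q.1.1.1 t = true ∧ a ≠ b ∧ twoTp n m a b = q.1.1 ∧ oneTp n m b = q.2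
        then 1 else 0 := by
    split_ifs with h <;> simp [h]
  simp only [this]
  rw [Finset.sum_comm]
  refine Finset.sum_congr rfl fun b _ => ?_
  split_ifs with h
  · have haud : twoTp n m a b ≠ silent m := by
      intro h0
      have := congrFun (congrArg Prod.fst h0) t
      simp [twoTp, silent, h.1] at this
    rw [Finset.sum_eq_single (⟨twoTp n m a b, haud⟩, oneTp n m b)]
    · rw [if_pos]
      exact ⟨((hasTwoTp_twoTp a b).1 t).mpr h.1, h.2, rfl, rfl⟩
    · rintro ⟨⟨η, hη⟩, π⟩ _ hne
      rw [if_neg]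
      rintro ⟨-, -, rfl, rfl⟩
      exact hne rfl
    · simp
  · refine (Finset.sum_eq_zero fun q _ => if_neg ?_).symm
    rintro ⟨h1, h2, h3, -⟩
    rw [← h3] at h1
    exact h ⟨((hasTwoTp_twoTp a b).1 t).mp h1, h2⟩

theorem NormalForm.Models.behavior_mem {φ : NormalForm n m} (h : φ.Models M) (a : M) :
    behavior n m a ∈ φ.behaviors (oneTp n m a) := by
  classical
  rw [NormalForm.mem_behaviors_iff]
  refine ⟨fun q hq => Finset.sum_eq_zero fun b _ => if_neg ?_, fun i hi => ?_⟩
  · rintro ⟨hab, h1, h2⟩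
    refine hq ?_
    rw [← h1, ← h2]
    exact ⟨h.compat₁ b, h.compat₂ hab⟩
  · have := h.2.2 i a (((hasOneTp_oneTp a).1 i).mp hi)
    simpa only [card_successors] using this

open Classical in
/-- The number of pairs of distinct elements with given types. -/
def pairCount {M : Type} [(voc n m).Structure M] [Fintype M] (π₁ : OneTp n m) (η : TwoTp m)
    (π₂ : OneTp n m) : ℕ :=
  ∑ a : M, ∑ b : M, if oneTp n m a = π₁ ∧ a ≠ b ∧ twoTp n m a b = η ∧ oneTp n m b = π₂
    then 1 else 0

open Classical in
theorem pairCount_eq_sum_behavior (π₁ : OneTp n m) (η : AudTp m) (π₂ : OneTp n m) :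
    pairCount (M := M) π₁ η.1 π₂ =
      ∑ a : M with oneTp n m a = π₁, behavior n m a (η, π₂) := by
  rw [Finset.sum_filter]
  refine Finset.sum_congr rfl fun a _ => ?_
  split_ifs with h <;> simp [h, behavior]

theorem pairCount_dual (π₁ : OneTp n m) (η : TwoTp m) (π₂ : OneTp n m) :
    pairCount (M := M) π₁ η π₂ = pairCount (M := M) π₂ (dual η) π₁ := by
  classical
  rw [pairCount, Finset.sum_comm]
  refine Finset.sum_congr rfl fun b _ => Finset.sum_congr rfl fun a _ => ?_
  refine if_congr ⟨?_, ?_⟩ rfl rfl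
  · rintro ⟨h1, h2, rfl, h4⟩
    exact ⟨h4, h2.symm, rfl, h1⟩
  · rintro ⟨h1, h2, h3, h4⟩
    refine ⟨h4, h2.symm, ?_, h1⟩
    rw [← dual_twoTp, h3]
    rfl

theorem NormalForm.Models.row_pairCount {φ : NormalForm n m} (h : φ.Models M) (π : φ.CompatTp) :
    ∃ l : List (AudTp m × OneTp n m → ℕ), (∀ b ∈ l, b ∈ φ.behaviors π.1) ∧
      l.sum = φ.row (fun π₁ η π₂ => pairCount (M := M) π₁.1 η.1 π₂.1) π := by
  classical
  refine ⟨((Finset.univ.filter fun a : M => oneTp n m a = π.1).toList.map (behavior n m)), ?_, ?_⟩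
  · intro b hb
    obtain ⟨a, ha, rfl⟩ := List.mem_map.mp hb
    have ha : oneTp n m a = π.1 := by simpa using ha
    rw [← ha]
    exact h.behavior_mem a
  · rw [Finset.sum_map_toList]
    ext ⟨η, π'⟩
    rw [Finset.sum_apply, NormalForm.row]
    split_ifs with hc
    · exact (pairCount_eq_sum_behavior _ _ _).symm
    -- The entries that `row` sets to `0` are truly `0`: only compatible types are realized.
    · refine Finset.sum_eq_zero fun a _ => Finset.sum_eq_zero fun b _ => if_neg ?_
      rintro ⟨-, -, rfl⟩
      exact hc (h.compat₁ b)

theorem NormalForm.Models.exists_isSolutionQ {φ : NormalForm n m} [Nonempty M] (h : φ.Models M)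
    (h0 : ∀ π : OneTp n m, φ.Compat₁ π → (0 : AudTp m × OneTp n m → ℕ) ∉ φ.behaviors π) :
    ∃ x : φ.CompatTp → AudTp m → φ.CompatTp → ℕ, φ.IsSolutionQ x := by
  classical
  refine ⟨fun π₁ η π₂ => pairCount (M := M) π₁.1 η.1 π₂.1, fun π => ?_,
    fun π₁ η π₂ => pairCount_dual _ _ _, ?_⟩
  · exact ((φ.charSystem π.1).tildeSol_iff_exists_list (h0 π.1 π.2) _).mpr (h.row_pairCount π)
  · obtain ⟨a⟩ := ‹Nonempty M›
    -- As `0` is not a behavior, `a` has a neighbor by an audible 2-type, which gives a positive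
    -- variable.
    have hne : behavior n m a ≠ 0 := fun hz => h0 _ (h.compat₁ a) (hz ▸ h.behavior_mem a)
    obtain ⟨⟨η, π'⟩, hq⟩ := Function.ne_iff.mp hne
    obtain ⟨b, -, hb⟩ := Finset.exists_ne_zero_of_sum_ne_zero hq
    have hπ : oneTp n m b = π' := by
      by_contra hc
      exact hb (if_neg fun h => hc h.2.2)
    subst hπ
    refine Finset.sum_pos' (fun _ _ => Nat.zero_le _) ⟨⟨_, h.compat₁ a⟩, Finset.mem_univ _, ?_⟩
    refine Finset.sum_pos' (fun _ _ => Nat.zero_le _) ⟨η, Finset.mem_univ _, ?_⟩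
    refine Finset.sum_pos' (fun _ _ => Nat.zero_le _) ⟨⟨_, h.compat₁ b⟩, Finset.mem_univ _, ?_⟩
    rw [pairCount_eq_sum_behavior]
    exact Finset.sum_pos' (fun _ _ => Nat.zero_le _)
      ⟨a, by simp, Nat.pos_of_ne_zero hq⟩

end Model

/-! ### Pairing stubs and lifting to a simple graph. -/

section Lift

/-- If the classes `k` and `bar k` have the same size for every `k`, some involution swaps them. -/
theorem exists_involution {S K : Type} [Finite S] (cls : S → K) (bar : K → K)
    (hbar : Function.Involutive bar)
    (hcard : ∀ k, Nat.card {s // cls s = k} = Nat.card {s // cls s = bar k}) :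
    ∃ σ : S → S, Function.Involutive σ ∧ ∀ s, cls (σ s) = bar (cls s) := by
  -- Number the members of each class once and for all; `σ` keeps the number and changes the class
  -- from `k` to `bar k`. A class with `bar k = k` is thus fixed pointwise.
  let e (k : K) : {s // cls s = k} ≃ Fin (Nat.card {s // cls s = k}) := Finite.equivFin _
  let r (s : S) : ℕ := e (cls s) ⟨s, rfl⟩
  have hr (k : K) (s : {s // cls s = k}) : r s = e k s := by
    obtain ⟨s, rfl⟩ := s
    rfl
  have inj (s s' : S) (h : cls s = cls s') (h' : r s = r s') : s = s' := by
    have h2 : e (cls s') ⟨s, h⟩ = e (cls s') ⟨s', rfl⟩ := by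
      ext
      rw [← hr, ← hr]
      exact h'
    exact congrArg Subtype.val ((e _).injective h2)
  have surj (s : S) : ∃ s', cls s' = bar (cls s) ∧ r s' = r s := by
    have hlt : r s < Nat.card {s' // cls s' = bar (cls s)} :=
      (e (cls s) ⟨s, rfl⟩).isLt.trans_eq (hcard _)
    refine ⟨(e (bar (cls s))).symm ⟨r s, hlt⟩, ((e _).symm _).property, ?_⟩
    rw [hr, Equiv.apply_symm_apply]
  choose σ h1 h2 using surj
  refine ⟨σ, fun s => inj _ _ ?_ ?_, h1⟩
  · rw [h1, h1, hbar]
  · rw [h2, h2]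

variable {S : Type} [DecidableEq S]

/-- Distinct shifts for the elements of `S`, which the involution `σ` maps to their negatives. -/
def shift (σ : S → S) (s : S) : S → ZMod 4 :=
  fun t => if σ s = s then (if t = s then 2 else 0)
    else if t = s then 3 else if t = σ s then 1 else 0

/-- The values `2` and `3` mark the coordinate `s`, so a stub can be read off its shift. `ZMod 4`
offers both an element `2 = -2` for the fixed stubs and distinct `1` and `3 = -1` for the two ends
of an ordinary pair. -/
theorem shift_apply_mem_iff (σ : S → S) (s t : S) :
    (shift σ s t = 2 ∨ shift σ s t = 3) ↔ t = s := by
  unfold shift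
  have h1 : (2 : ZMod 4) ≠ 3 := by decide
  have h2 : ¬ ((0 : ZMod 4) = 2 ∨ (0 : ZMod 4) = 3) := by decide
  have h3 : ¬ ((1 : ZMod 4) = 2 ∨ (1 : ZMod 4) = 3) := by decide
  split_ifs <;> simp_all

theorem shift_injective (σ : S → S) : Function.Injective (shift σ) := fun s s' h => by
  have := (shift_apply_mem_iff σ s s).mpr rfl
  rw [h] at this
  exact (shift_apply_mem_iff σ s' s).mp this

theorem shift_ne_zero (σ : S → S) (s : S) : shift σ s ≠ 0 := fun h => by
  have := (shift_apply_mem_iff σ s s).mpr rfl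
  rw [h] at this
  revert this
  simp only [Pi.zero_apply]
  decide

theorem shift_involution {σ : S → S} (hσ : Function.Involutive σ) (s : S) :
    shift σ (σ s) = -shift σ s := by
  ext t
  simp only [shift, hσ s, Pi.neg_apply]
  have h1 : (-2 : ZMod 4) = 2 := by decide
  have h2 : (-3 : ZMod 4) = 1 := by decide
  have h3 : (-1 : ZMod 4) = 3 := by decide
  by_cases h : σ s = s
  · simp only [h, if_true]
    split_ifs <;> simp [h1]
  · rw [if_neg h, if_neg (Ne.symm h)]
    by_cases ht : t = s
    · rw [if_pos ht, if_pos ht, if_neg (by rw [ht]; exact Ne.symm h), h2]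
    · rw [if_neg ht, if_neg ht]
      split_ifs <;> simp [h3]

/-- The stubs `s` and `σ s` join two points of a lift of the set of owners. -/
def Joins {V : Type} (own : S → V) (σ : S → S) (s : S) (a b : V × (S → ZMod 4)) : Prop :=
  own s = a.1 ∧ own (σ s) = b.1 ∧ b.2 = a.2 + shift σ s

variable {V : Type} {own : S → V} {σ : S → S} {s s' : S} {a b : V × (S → ZMod 4)}

theorem Joins.symm (hσ : Function.Involutive σ) (h : Joins own σ s a b) :
    Joins own σ (σ s) b a := by
  refine ⟨h.2.1, by rw [hσ, h.1], ?_⟩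
  rw [shift_involution hσ, h.2.2]
  abel

theorem Joins.ne (h : Joins own σ s a b) : a ≠ b := by
  rintro rfl
  exact shift_ne_zero σ s (left_eq_add.mp h.2.2)

theorem Joins.unique (h : Joins own σ s a b) (h' : Joins own σ s' a b) : s = s' :=
  shift_injective σ (add_left_cancel (h.2.2.symm.trans h'.2.2))

/-- A point above `v` has one neighbor for each stub of `v`, and different stubs lead to different
points, since their shifts differ even when the owners at the far end coincide. -/
theorem Joins.card_eq [Finite S] (P : S → Prop) (a : V × (S → ZMod 4)) :
    Nat.card {b // ∃ s, Joins own σ s a b ∧ P s} = Nat.card {s // own s = a.1 ∧ P s} := by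
  refine (Nat.card_congr (Equiv.ofBijective (fun s => ⟨(own (σ s.1), a.2 + shift σ s.1),
    s.1, ⟨s.2.1, rfl, rfl⟩, s.2.2⟩) ⟨?_, ?_⟩)).symm
  · rintro ⟨s, hs⟩ ⟨s', hs'⟩ h
    have h := congrArg (fun b => b.1.2) h
    exact Subtype.ext (shift_injective σ (add_left_cancel h))
  · rintro ⟨b, s, hs, hP⟩
    exact ⟨⟨s, hs.1, hP⟩, Subtype.ext (Prod.ext hs.2.1 hs.2.2.symm)⟩

end Lift

/-! ### From a solution of `Q` to a finite model. -/

section Build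

variable {n m : ℕ}

variable {V : Type} (tp : V → OneTp n m) (bh : V → AudTp m × OneTp n m → ℕ)

/-- The stubs of the elements of `V` with the given behaviors. -/
abbrev Stub : Type := Σ v : V, Σ q : AudTp m × OneTp n m, Fin (bh v q)

open Classical in
theorem card_stub_class [Fintype V] (k : OneTp n m × AudTp m × OneTp n m) :
    Nat.card {s : Stub bh // (tp s.1, s.2.1) = k} =
      ∑ v, if tp v = k.1 then bh v k.2 else 0 := by
  rw [Nat.card_eq_fintype_card, Fintype.card_subtype, Finset.card_filter, Fintype.sum_sigma]
  refine Finset.sum_congr rfl fun v _ => ?_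
  rw [Fintype.sum_sigma, Finset.sum_eq_single k.2]
  · simp [Prod.ext_iff]
  · intro q _ hq
    refine Finset.sum_eq_zero fun i _ => if_neg fun h => hq (congrArg Prod.snd h)
  · simp

theorem card_stub_of [Fintype V] (v : V) (P : AudTp m × OneTp n m → Prop) [DecidablePred P] :
    Nat.card {s : Stub bh // s.1 = v ∧ P s.2.1} = ∑ q, if P q then bh v q else 0 := by
  classical
  rw [Nat.card_eq_fintype_card, Fintype.card_subtype, Finset.card_filter, Fintype.sum_sigma,
    Finset.sum_eq_single v]
  · rw [Fintype.sum_sigma]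
    refine Finset.sum_congr rfl fun q _ => ?_
    simp
  · intro w _ hw
    refine Finset.sum_eq_zero fun s _ => if_neg fun h => hw h.1
  · simp

open Classical in
/-- The structure in which `σ`-related stubs are joined. -/
abbrev liftStructure (σ : Stub bh → Stub bh) :
    (voc n m).Structure (V × (Stub bh → ZMod 4)) where
  funMap f := (f : Empty).elim
  RelMap {k} R := match k, R with
    | _, .U i => fun a => (tp (a 0).1).1 i = true
    | _, .R i => fun a => (a 0 = a 1 ∧ (tp (a 0).1).2 i = true) ∨
        ∃ s, Joins Sigma.fst σ s (a 0) (a 1) ∧ s.2.1.1.1.1 i = true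

/-- If the stubs of dual classes are equinumerous, some finite model realizes the behaviors. -/
theorem finitelySatisfiable_of_behaviors (φ : NormalForm n m) [Finite V] [Nonempty V]
    (hcompat : ∀ v, φ.Compat₁ (tp v)) (hbh : ∀ v, bh v ∈ φ.behaviors (tp v))
    (hcard : ∀ π η π', Nat.card {s : Stub bh // (tp s.1, s.2.1) = (π, η, π')} =
      Nat.card {s : Stub bh // (tp s.1, s.2.1) = (π', AudTp.dual η, π)}) :
    φ.FinitelySatisfiable := by
  classical
  have := Fintype.ofFinite V
  obtain ⟨σ, hσ, hcls⟩ := exists_involution (fun s : Stub bh => (tp s.1, s.2.1))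
    (fun k => (k.2.2, AudTp.dual k.2.1, k.1)) (fun _ => rfl) (fun k => hcard k.1 k.2.1 k.2.2)
  have htp (s : Stub bh) : tp (σ s).1 = s.2.1.2 := congrArg Prod.fst (hcls s)
  have hlab (s : Stub bh) : (σ s).2.1.1.1 = dual s.2.1.1.1 :=
    congrArg (fun k => k.2.1.1) (hcls s)
  let M := V × (Stub bh → ZMod 4)
  let inst : (voc n m).Structure M := liftStructure tp bh σ
  have hU (i : Fin n) (a : M) : HoldsU (m := m) i a ↔ (tp a.1).1 i = true := Iff.rfl
  have hR (i : Fin m) (a b : M) : HoldsR (n := n) i a b ↔ (a = b ∧ (tp a.1).2 i = true) ∨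
      ∃ s, Joins Sigma.fst σ s a b ∧ s.2.1.1.1.1 i = true := Iff.rfl
  have hR1 (i : Fin m) (a : M) : HoldsR (n := n) i a a ↔ (tp a.1).2 i = true := by
    rw [hR]
    refine ⟨?_, fun h => Or.inl ⟨rfl, h⟩⟩
    rintro (h | ⟨s, h, -⟩)
    · exact h.2
    · exact absurd rfl h.ne
  have hR2 (i : Fin m) {a b : M} (hab : a ≠ b) :
      HoldsR (n := n) i a b ↔ ∃ s, Joins Sigma.fst σ s a b ∧ s.2.1.1.1.1 i = true := by
    rw [hR, or_iff_right fun h => hab h.1]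
  have hR3 (i : Fin m) {a b : M} {s : Stub bh} (h : Joins Sigma.fst σ s a b) :
      s.2.1.1.1.1 i = true ↔ HoldsR (n := n) i a b := by
    rw [hR2 i h.ne]
    refine ⟨fun h' => ⟨s, h, h'⟩, ?_⟩
    rintro ⟨s', h1, h2⟩
    rwa [h.unique h1]
  have hone (a : M) : HasOneTp a (tp a.1) := ⟨fun i => (hU i a).symm, fun i => (hR1 i a).symm⟩
  have htwo {a b : M} {s : Stub bh} (h : Joins Sigma.fst σ s a b) :
      HasTwoTp n a b s.2.1.1.1 := by
    refine ⟨fun i => hR3 i h, fun i => ?_⟩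
    rw [← hR3 i (h.symm hσ), hlab]
    rfl
  refine ⟨M, inferInstance, inferInstance, inst, fun a => hcompat a.1 M a (hone a),
    fun i a b hab => ?_, fun i a hi => ?_⟩
  · obtain ⟨s, hs, -⟩ := (hR2 i hab.2).mp hab.1
    have hpos : bh s.1 s.2.1 ≠ 0 := fun h0 => (h0 ▸ s.2.2 : Fin 0).elim0
    have hc := not_imp_comm.mp (((φ.mem_behaviors_iff _ _).mp (hbh s.1)).1 s.2.1) hpos
    have h1 : tp s.1 = tp a.1 := congrArg tp hs.1
    have h2 : tp (σ s).1 = tp b.1 := congrArg tp hs.2.1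
    rw [← htp, h1, h2] at hc
    exact hc.2.1 M a b (hone a) (htwo hs) (hone b) i hab
  · have h := ((φ.mem_behaviors_iff _ _).mp (hbh a.1)).2 i hi
    convert h using 1
    refine Finset.sum_congr rfl fun t _ => ?_
    have hset : Nat.card {b : M // HoldsR (n := n) t a b ∧ a ≠ b} =
        Nat.card {b : M // ∃ s : Stub bh, Joins Sigma.fst σ s a b ∧ s.2.1.1.1.1 t = true} := by
      refine Nat.card_congr (Equiv.subtypeEquivRight fun b => ?_)
      constructor
      · rintro ⟨h1, h2⟩
        exact (hR2 t h2).mp h1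
      · rintro ⟨s, hs, hst⟩
        exact ⟨(hR3 t hs).mp hst, hs.ne⟩
    rw [hset, Joins.card_eq (fun s : Stub bh => s.2.1.1.1.1 t = true) a,
      card_stub_of bh a.1 fun q => q.1.1.1 t = true]

theorem NormalForm.IsSolutionQ.finitelySatisfiable {φ : NormalForm n m}
    {x : φ.CompatTp → AudTp m → φ.CompatTp → ℕ} (hx : φ.IsSolutionQ x)
    (h0 : ∀ π : OneTp n m, φ.Compat₁ π → (0 : AudTp m × OneTp n m → ℕ) ∉ φ.behaviors π) :
    φ.FinitelySatisfiable := by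
  classical
  have hl (π : φ.CompatTp) :=
    ((φ.charSystem π.1).tildeSol_iff_exists_list (h0 π.1 π.2) _).mp (hx.structural π)
  choose l hmem hsum using hl
  let V := Σ π : φ.CompatTp, Fin (l π).length
  let tp : V → OneTp n m := fun v => v.1.1
  let bh : V → AudTp m × OneTp n m → ℕ := fun v => (l v.1)[v.2]
  have hV : Nonempty V := by
    obtain ⟨π, -, h⟩ := Finset.exists_ne_zero_of_sum_ne_zero hx.nontrivial.ne'
    obtain ⟨η, -, h⟩ := Finset.exists_ne_zero_of_sum_ne_zero h
    obtain ⟨π', -, h⟩ := Finset.exists_ne_zero_of_sum_ne_zero h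
    refine ⟨⟨π, 0, List.length_pos_of_ne_nil fun hnil => h ?_⟩⟩
    have := congrFun (hsum π) (η, π'.1)
    rw [hnil, List.sum_nil, NormalForm.row, dif_pos π'.2] at this
    exact this.symm
  have hclass (π : OneTp n m) (η : AudTp m) (π' : OneTp n m) :
      Nat.card {s : Stub bh // (tp s.1, s.2.1) = (π, η, π')} =
        if h : φ.Compat₁ π ∧ φ.Compat₁ π' then x ⟨π, h.1⟩ η ⟨π', h.2⟩ else 0 := by
    rw [card_stub_class tp bh, Fintype.sum_sigma]
    have hin (ρ : φ.CompatTp) : ∑ i : Fin (l ρ).length, bh ⟨ρ, i⟩ (η, π') =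
        φ.row x ρ (η, π') := by
      rw [← hsum ρ, Pi.list_sum_apply, ← Fin.sum_univ_fun_getElem]
      rfl
    by_cases hπ : φ.Compat₁ π
    · rw [Finset.sum_eq_single ⟨π, hπ⟩]
      · simp only [tp, if_true, hin, NormalForm.row, hπ, true_and]
      · intro ρ _ hρ
        refine Finset.sum_eq_zero fun i _ => if_neg fun h => hρ (Subtype.ext h)
      · simp
    · rw [dif_neg fun h => hπ h.1]
      refine Finset.sum_eq_zero fun ρ _ => Finset.sum_eq_zero fun i _ => if_neg ?_
      rintro rfl
      exact hπ ρ.2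
  refine finitelySatisfiable_of_behaviors tp bh φ (fun v => v.1.2)
    (fun v => hmem v.1 _ (List.getElem_mem _)) fun π η π' => ?_
  rw [hclass, hclass]
  by_cases h : φ.Compat₁ π ∧ φ.Compat₁ π'
  · rw [dif_pos h, dif_pos h.symm]
    exact hx.matching _ _ _
  · rw [dif_neg h, dif_neg fun h' => h h'.symm]

end Build

end GP2

end

theorem lemma4p5 {n m : ℕ} (φ : GP2.NormalForm n m)
    (hφ : ∀ π : GP2.OneTp n m, φ.Compat₁ π → (0 : GP2.AudTp m × GP2.OneTp n m → ℕ) ∉ φ.behaviors π) :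
    φ.FinitelySatisfiable ↔
      ∃ x : φ.CompatTp → GP2.AudTp m → φ.CompatTp → ℕ, φ.IsSolutionQ x := by
  constructor
  · rintro ⟨M, _, _, _, hM⟩
    have := Fintype.ofFinite M
    exact hM.exists_isSolutionQ hφ
  · rintro ⟨x, hx⟩
    exact hx.finitelySatisfiable hφ
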